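/- Let $d\ge 1$, $\alpha>0$ and $J\ge 0$. For $i\in\mathbb Z^d$ let $N(i)$ be the set of its $2d$ nearest neighbours. For a finite set $\Lambda\subset\mathbb Z^d$ and a boundary condition $\omega\in\mathbb R^{\mathbb Z^d}$ define, for $x=(x_i)_{i\in\Lambda}\in\mathbb R^{\Lambda}$, $$U_\Lambda^\omega(x)=\sum_{i\in\Lambda}\alpha x_i^2+J\sum_{\langle ij\rangle:\,i,j\in\Lambda}(x_i-x_j)^2+J\sum_{i\in\Lambda}\ \sum_{j\in N(i)\setminus\Lambda}(x_i-\omega_j)^2,$$ where the second sum runs over the unordered nearest-neighbour pairs contained in $\Lambda$. For a function $U$ on $\mathbb R^\Lambda$ with $Z=\int e^{-U(x)}\,dx<\infty$ put $\mu_U(dx)=e^{-U(x)}\,dx/Z$. The spectral gap $\lambda_1(U)\in[0,\infty]$ is the largest constant $\kappa$ such that $$\kappa\,\mathrm{Var}_{\mu_U}(f)\le\int|\nabla f|^2\,d\mu_U\qquad\text{for all } f\in C_c^\infty(\mathbb R^\Lambda).$$ The logarithmic Sobolev constant $\sigma(U)\in[0,\infty]$ is the largest constant $\kappa$ such that $$\kappa\,\mathrm{Ent}_{\mu_U}(f^2)\le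 2D(f)\qquad\text{for all } f\in\mathscr D(D),$$ where $\mathrm{Ent}_{\mu}(g)=\mu(g\log g)-\mu(g)\log\mu(g)\in[0,\infty]$ for $\mu$-integrable $g\ge 0$, and $(D,\mathscr D(D))$ is the closure in $L^2(\mu_U)$ of the form $D(f)=\int|\nabla f|^2\,d\mu_U$, $f\in C_c^\infty(\mathbb R^\Lambda)$. Then every $\mu_{U_\Lambda^\omega}$ is a well-defined probability measure, and $$\inf_{\Lambda}\inf_{\omega}\lambda_1(U_\Lambda^\omega)\ \ge\ \inf_{\Lambda}\inf_{\omega}\sigma(U_\Lambda^\omega)\ \ge\ 2\alpha,$$ where the infima are over all finite $\Lambda\subset\mathbb Z^d$ and all $\omega\in\mathbb R^{\mathbb Z^d}$. -/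

import Mathlib

open MeasureTheory ProbabilityTheory Filter Topology

noncomputable section

namespace SpinSystem

section FiniteDimensional

variable {ι : Type*} [Fintype ι]

/-- The measure `μ_U(dx) = e^{-U(x)} dx / Z` with `Z = ∫ e^{-U(x)} dx` on `ℝ^ι`. -/
def gibbsMeasure (U : EuclideanSpace ℝ ι → ℝ) : Measure (EuclideanSpace ℝ ι) :=
  (volume : Measure (EuclideanSpace ℝ ι)).tilted (fun x => -U x)

/-- Smooth functions with compact support. -/
def IsTestFunction (f : EuclideanSpace ℝ ι → ℝ) : Prop :=
  ContDiff ℝ ((⊤ : ℕ∞) : WithTop ℕ∞) f ∧ HasCompactSupport f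

/-- The spectral gap `λ₁(U)`: the largest constant `κ` in the Poincaré inequality
`κ Var_{μ_U}(f) ≤ ∫ |∇f|² dμ_U`, `f ∈ C_c^∞` (it is `⊤` if every `κ` is admissible). -/
def spectralGap (U : EuclideanSpace ℝ ι → ℝ) : EReal :=
  sSup ((fun κ : ℝ => (κ : EReal)) '' {κ : ℝ | ∀ f : EuclideanSpace ℝ ι → ℝ, IsTestFunction f →
    κ * Var[f; gibbsMeasure U] ≤ ∫ x, ‖gradient f x‖ ^ 2 ∂(gibbsMeasure U)})

/-- `f` belongs to the domain of the Dirichlet form `D(f) = ∫ |∇f|² dμ_U`, the closure in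
`L²(μ_U)` of the form given on `C_c^∞`, and `G` is its gradient: `f` and `G` are the `L²(μ_U)`
limits of `φ n` and `∇(φ n)` for some sequence of test functions, so that `D(f) = ∫ |G|² dμ_U`. -/
def HasFormGradient (U : EuclideanSpace ℝ ι → ℝ) (f : EuclideanSpace ℝ ι → ℝ)
    (G : EuclideanSpace ℝ ι → EuclideanSpace ℝ ι) : Prop :=
  MemLp f 2 (gibbsMeasure U) ∧ MemLp G 2 (gibbsMeasure U) ∧
    ∃ φ : ℕ → EuclideanSpace ℝ ι → ℝ, (∀ n, IsTestFunction (φ n)) ∧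
      Tendsto (fun n => eLpNorm (fun x => φ n x - f x) 2 (gibbsMeasure U)) atTop (𝓝 0) ∧
      Tendsto (fun n => eLpNorm (fun x => gradient (φ n) x - G x) 2 (gibbsMeasure U))
        atTop (𝓝 0)

open Classical in
/-- `Ent_μ(g) = μ(g log g) - μ(g) log μ(g)` for an integrable `g ≥ 0` and a probability measure
`μ`. As `t log t` is bounded below, it is `+∞` when `g log g` is not integrable. -/
def entropy {Ω : Type*} [MeasurableSpace Ω] (μ : Measure Ω) (g : Ω → ℝ) : EReal :=
  if Integrable (fun x => g x * Real.log (g x)) μ then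
    ((∫ x, g x * Real.log (g x) ∂μ - (∫ x, g x ∂μ) * Real.log (∫ x, g x ∂μ) : ℝ) : EReal)
  else ⊤

/-- The logarithmic Sobolev constant `σ(U)`: the largest constant `κ` in
`κ Ent_{μ_U}(f²) ≤ 2 D(f)`, for all `f` in the domain of the Dirichlet form. -/
def logSobolevConstant (U : EuclideanSpace ℝ ι → ℝ) : EReal :=
  sSup ((fun κ : ℝ => (κ : EReal)) '' {κ : ℝ | ∀ (f : EuclideanSpace ℝ ι → ℝ)
    (G : EuclideanSpace ℝ ι → EuclideanSpace ℝ ι), HasFormGradient U f G →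
      (κ : EReal) * entropy (gibbsMeasure U) (fun x => f x ^ 2) ≤
        ((2 * ∫ x, ‖G x‖ ^ 2 ∂(gibbsMeasure U) : ℝ) : EReal)})

end FiniteDimensional

/-- The set `N(i)` of the `2d` nearest neighbours of a site `i ∈ ℤ^d`. -/
def neighbours {d : ℕ} (i : Fin d → ℤ) : Finset (Fin d → ℤ) :=
  (Finset.univ.image fun k => i + Pi.single k 1) ∪ (Finset.univ.image fun k => i - Pi.single k 1)

/-- The finite volume potential `U_Λ^ω` with one-site potential `u`, interaction
`J ∑_{⟨ij⟩} (x_i - x_j)²` and boundary condition `ω`. In the first double sum every bond inside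
`Λ` occurs twice, as `(i, j)` and as `(j, i)`, whence the factor `1 / 2`. -/
def latticePotential {d : ℕ} (u : ℝ → ℝ) (J : ℝ) (Λ : Finset (Fin d → ℤ))
    (ω : (Fin d → ℤ) → ℝ) (x : EuclideanSpace ℝ Λ) : ℝ :=
  ∑ i : Λ, u (x i)
    + J * ((1 / 2) * ∑ i : Λ,
        ∑ j ∈ Finset.univ.filter (fun j : Λ => (j : Fin d → ℤ) ∈ neighbours (i : Fin d → ℤ)),
          (x i - x j) ^ 2)
    + J * ∑ i : Λ, ∑ j ∈ neighbours (i : Fin d → ℤ) \ Λ, (x i - ω j) ^ 2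

end SpinSystem

end

open scoped InnerProductSpace

/-! The potential is a quadratic polynomial. Interaction and boundary terms are squares with weight
`J ≥ 0`, so its quadratic part is at least `α ‖x‖²`, while `ω` enters only the linear and constant
parts. Hence each Gibbs measure is Gaussian with covariance at most `1 / (2α)`, uniformly in `Λ` and
`ω`, and in an orthonormal eigenbasis it is a product of Gaussians on the line
(`IsQuadratic.exists_gibbsMeasure_eq_map`).

For variance `v` on the line, `Ent(g) ≤ (v / 2) ∫ g'² / g` follows from monotone transport of `g dγ`
onto the Gaussian `γ` (`integral_mul_log_gaussianReal_std_le`). Subadditivity of entropy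
(`realEntropy_pi_le`) carries this to products. Taking `g = f² + ε` and letting `ε → 0` gives
`Ent(f²) ≤ (1 / α) D(f)` for test functions, and Fatou's lemma extends it to the closed form
(`HasFormGradient.entropy_sq_le`); this is `σ ≥ 2α`.

The comparison `λ₁ ≥ σ` is linearization: for centred `h`, `Ent((1 + t h)²) = 2 t² Var(h) + O(t³)`,
whereas the energy of `1 + t h` is `t² D(h)`. -/

namespace SpinSystem

/-! ### Entropy of bounded functions and its tensorization. -/

section BoundedMeasurable

variable {α β : Type*} [MeasurableSpace α] [MeasurableSpace β]

/-- Bounded measurable real functions. -/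
def IsBddMeasurable (f : α → ℝ) : Prop := Measurable f ∧ ∃ C, ∀ x, |f x| ≤ C

namespace IsBddMeasurable

theorem of_mem_Icc {f : α → ℝ} (hf : Measurable f) {a b : ℝ} (h : ∀ x, a ≤ f x ∧ f x ≤ b) :
    IsBddMeasurable f :=
  ⟨hf, max |a| |b|, fun x => abs_le_max_abs_abs (h x).1 (h x).2⟩

theorem const (c : ℝ) : IsBddMeasurable (fun _ : α => c) := ⟨measurable_const, |c|, fun _ => le_rfl⟩

theorem integrable {f : α → ℝ} (hf : IsBddMeasurable f) (μ : Measure α) [IsFiniteMeasure μ] :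
    Integrable f μ :=
  let ⟨C, hC⟩ := hf.2
  Integrable.of_bound hf.1.aestronglyMeasurable C (ae_of_all _ hC)

theorem mul {f g : α → ℝ} (hf : IsBddMeasurable f) (hg : IsBddMeasurable g) :
    IsBddMeasurable (fun x => f x * g x) := by
  obtain ⟨C, hC⟩ := hf.2
  obtain ⟨D, hD⟩ := hg.2
  refine ⟨hf.1.mul hg.1, C * D, fun x => ?_⟩
  rw [abs_mul]
  exact mul_le_mul (hC x) (hD x) (abs_nonneg _) ((abs_nonneg _).trans (hC x))

theorem add {f g : α → ℝ} (hf : IsBddMeasurable f) (hg : IsBddMeasurable g) :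
    IsBddMeasurable (fun x => f x + g x) := by
  obtain ⟨C, hC⟩ := hf.2
  obtain ⟨D, hD⟩ := hg.2
  exact ⟨hf.1.add hg.1, C + D, fun x => (abs_add_le _ _).trans (add_le_add (hC x) (hD x))⟩

theorem neg {f : α → ℝ} (hf : IsBddMeasurable f) : IsBddMeasurable (fun x => -f x) := by
  obtain ⟨C, hC⟩ := hf.2
  exact ⟨hf.1.neg, C, fun x => by simpa using hC x⟩

theorem sub {f g : α → ℝ} (hf : IsBddMeasurable f) (hg : IsBddMeasurable g) :
    IsBddMeasurable (fun x => f x - g x) := by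
  simpa only [sub_eq_add_neg] using hf.add hg.neg

theorem comp {f : β → ℝ} (hf : IsBddMeasurable f) {e : α → β} (he : Measurable e) :
    IsBddMeasurable (fun x => f (e x)) :=
  let ⟨C, hC⟩ := hf.2
  ⟨hf.1.comp he, C, fun x => hC (e x)⟩

theorem finsetSum {ι : Type*} (s : Finset ι) {f : ι → α → ℝ} (hf : ∀ i ∈ s, IsBddMeasurable (f i)) :
    IsBddMeasurable (fun x => ∑ i ∈ s, f i x) := by
  classical
  induction s using Finset.induction_on with
  | empty => simpa using const (α := α) 0
  | insert i s hi ih =>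
    simp only [Finset.sum_insert hi]
    exact (hf i (Finset.mem_insert_self i s)).add
      (ih fun j hj => hf j (Finset.mem_insert_of_mem hj))

theorem log {f : α → ℝ} (hf : IsBddMeasurable f) {a : ℝ} (ha : 0 < a) (h : ∀ x, a ≤ f x) :
    IsBddMeasurable (fun x => Real.log (f x)) := by
  obtain ⟨C, hC⟩ := hf.2
  exact of_mem_Icc (Real.measurable_log.comp hf.1) (a := Real.log a) (b := Real.log C) fun x =>
    ⟨Real.log_le_log ha (h x), Real.log_le_log (ha.trans_le (h x)) ((le_abs_self _).trans (hC x))⟩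

theorem integral_fst {f : α × β → ℝ} (hf : IsBddMeasurable f) (μ : Measure α)
    [IsProbabilityMeasure μ] : IsBddMeasurable (fun y => ∫ x, f (x, y) ∂μ) := by
  obtain ⟨C, hC⟩ := hf.2
  refine ⟨hf.1.stronglyMeasurable.integral_prod_left'.measurable, C, fun y => ?_⟩
  simpa using norm_integral_le_of_norm_le_const (μ := μ) (f := fun x => f (x, y)) (C := C)
    (ae_of_all _ fun x => hC (x, y))

theorem integral_snd {f : α × β → ℝ} (hf : IsBddMeasurable f) (ν : Measure β)
    [IsProbabilityMeasure ν] : IsBddMeasurable (fun x => ∫ y, f (x, y) ∂ν) :=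
  (hf.comp measurable_swap).integral_fst ν

end IsBddMeasurable

/-- The entropy `μ(g log g) - μ(g) log μ(g)` as a real number. -/
noncomputable def realEntropy (μ : Measure α) (g : α → ℝ) : ℝ :=
  ∫ x, g x * Real.log (g x) ∂μ - (∫ x, g x ∂μ) * Real.log (∫ x, g x ∂μ)

theorem le_integral_of_forall_le {μ : Measure α} [IsProbabilityMeasure μ] {f : α → ℝ} {a : ℝ}
    (hf : IsBddMeasurable f) (h : ∀ x, a ≤ f x) : a ≤ ∫ x, f x ∂μ := by
  simpa using integral_mono (μ := μ) (integrable_const a) (hf.integrable μ) h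

/-- The variational lower bound of the entropy. -/
theorem integral_mul_log_sub_le_realEntropy {μ : Measure α} [IsProbabilityMeasure μ] {g h : α → ℝ}
    (hg : IsBddMeasurable g) (hh : IsBddMeasurable h) {a b : ℝ} (ha : 0 < a) (hb : 0 < b)
    (hga : ∀ x, a ≤ g x) (hhb : ∀ x, b ≤ h x) :
    ∫ x, g x * Real.log (h x) ∂μ - (∫ x, g x ∂μ) * Real.log (∫ x, h x ∂μ) ≤ realEntropy μ g := by
  set c := ∫ x, g x ∂μ with hc
  set m := ∫ x, h x ∂μ with hm
  have hcpos : 0 < c := ha.trans_le (le_integral_of_forall_le hg hga)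
  have hmpos : 0 < m := hb.trans_le (le_integral_of_forall_le hh hhb)
  -- This is `log y ≤ y - 1` at `y = h c / (g m)`, times `g`. The term `g - h c / m` integrates to
  -- zero because `c` and `m` are the means of `g` and `h`.
  have key : ∀ x, g x * Real.log (h x) + g x * (Real.log c - Real.log m) + (g x - h x * (c / m))
      ≤ g x * Real.log (g x) := by
    intro x
    have hgx : 0 < g x := ha.trans_le (hga x)
    have hhx : 0 < h x := hb.trans_le (hhb x)
    have := Real.log_le_sub_one_of_pos (x := h x * (c / m) / g x) (by positivity)
    rw [Real.log_div (by positivity) hgx.ne', Real.log_mul hhx.ne' (by positivity),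
      Real.log_div hcpos.ne' hmpos.ne'] at this
    have h2 := mul_le_mul_of_nonneg_left this hgx.le
    have h3 : g x * (h x * (c / m) / g x - 1) = h x * (c / m) - g x := by
      field_simp
    rw [h3] at h2
    nlinarith [h2]
  have hI1 := (hg.mul (hh.log hb hhb))
  have hI2 := hg.mul (.const (Real.log c - Real.log m))
  have hI3 := hg.sub (hh.mul (.const (c / m)))
  have hI := integral_mono (μ := μ) (((hI1.add hI2).add hI3).integrable μ)
    ((hg.mul (hg.log ha hga)).integrable μ) key
  rw [integral_add ((hI1.add hI2).integrable μ) (hI3.integrable μ),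
    integral_add (hI1.integrable μ) (hI2.integrable μ), integral_mul_const,
    integral_sub (hg.integrable μ) ((hh.mul (.const (c / m))).integrable μ),
    integral_mul_const, ← hc, ← hm, mul_div_cancel₀ _ hmpos.ne'] at hI
  rw [realEntropy, ← hc]
  linarith

/-- Subadditivity of the entropy on a product of two probability spaces. -/
theorem realEntropy_prod_le (μ : Measure α) (ν : Measure β) [IsProbabilityMeasure μ]
    [IsProbabilityMeasure ν] {g : α × β → ℝ} (hg : IsBddMeasurable g) {a : ℝ} (ha : 0 < a)
    (hga : ∀ z, a ≤ g z) :
    realEntropy (μ.prod ν) g ≤ ∫ y, realEntropy μ (fun x => g (x, y)) ∂ν +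
      ∫ x, realEntropy ν (fun y => g (x, y)) ∂μ := by
  -- Chain rule: the entropy of `g` is the averaged entropy in `x` plus the entropy of the marginal
  -- `h`. The latter is bounded by testing every section `g (x, ·)` against `log h` and averaging
  -- over `x`.
  set h : β → ℝ := fun y => ∫ x, g (x, y) ∂μ with hh
  have hhB : IsBddMeasurable h := hg.integral_fst μ
  have hha : ∀ y, a ≤ h y := fun y =>
    le_integral_of_forall_le (hg.comp measurable_prodMk_right) fun x => hga (x, y)
  have hgl := hg.mul (hg.log ha hga)
  have hm : ∫ y, h y ∂ν = ∫ z, g z ∂(μ.prod ν) := (integral_prod_symm g (hg.integrable _)).symm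
  have hm' : ∫ x, ∫ y, g (x, y) ∂ν ∂μ = ∫ z, g z ∂(μ.prod ν) :=
    (integral_prod g (hg.integrable _)).symm
  have h1 : ∫ y, realEntropy μ (fun x => g (x, y)) ∂ν
      = ∫ z, g z * Real.log (g z) ∂(μ.prod ν) - ∫ y, h y * Real.log (h y) ∂ν := by
    simp only [realEntropy]
    rw [integral_sub ((hgl.integral_fst μ).integrable ν) ((hhB.mul (hhB.log ha hha)).integrable ν),
      integral_prod_symm _ (hgl.integrable _)]
  have hB2 : IsBddMeasurable (fun z : α × β => g z * Real.log (h z.2)) :=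
    hg.mul ((hhB.log ha hha).comp measurable_snd)
  have h2 : ∫ y, h y * Real.log (h y) ∂ν - (∫ y, h y ∂ν) * Real.log (∫ y, h y ∂ν)
      ≤ ∫ x, realEntropy ν (fun y => g (x, y)) ∂μ := by
    have hle : ∀ x, ∫ y, g (x, y) * Real.log (h y) ∂ν
        - (∫ y, g (x, y) ∂ν) * Real.log (∫ y, h y ∂ν) ≤ realEntropy ν (fun y => g (x, y)) :=
      fun x => integral_mul_log_sub_le_realEntropy (hg.comp measurable_prodMk_left) hhB ha ha
        (fun y => hga (x, y)) hha
    have hE : IsBddMeasurable fun x => realEntropy ν (fun y => g (x, y)) :=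
      (hgl.integral_snd ν).sub ((hg.integral_snd ν).mul ((hg.integral_snd ν).log ha fun x =>
        le_integral_of_forall_le (hg.comp measurable_prodMk_left) fun y => hga (x, y)))
    have hL := (hB2.integral_snd ν)
    have hR := (hg.integral_snd ν).mul (.const (Real.log (∫ y, h y ∂ν)))
    have := integral_mono (μ := μ) ((hL.sub hR).integrable μ) (hE.integrable μ) hle
    rw [integral_sub (hL.integrable μ) (hR.integrable μ), integral_mul_const, hm'] at this
    rw [← integral_prod _ (hB2.integrable _), integral_prod_symm _ (hB2.integrable _)] at this
    simp only [integral_mul_const] at this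
    rw [hm] at this ⊢
    exact this
  rw [h1, realEntropy]
  rw [hm] at h2
  linarith

theorem realEntropy_map {μ : Measure α} {e : α → β} (he : Measurable e) {g : β → ℝ}
    (hg : Measurable g) : realEntropy (μ.map e) g = realEntropy μ (fun x => g (e x)) := by
  have hgl : Measurable fun x => g x * Real.log (g x) := hg.mul (Real.measurable_log.comp hg)
  rw [realEntropy, realEntropy, integral_map he.aemeasurable hgl.aestronglyMeasurable,
    integral_map he.aemeasurable hg.aestronglyMeasurable]

theorem realEntropy_const_mul {μ : Measure α} [IsProbabilityMeasure μ] {g : α → ℝ}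
    (hg : IsBddMeasurable g) {a c : ℝ} (ha : 0 < a) (hga : ∀ x, a ≤ g x) (hc : 0 < c) :
    realEntropy μ (fun x => c * g x) = c * realEntropy μ g := by
  have hm : 0 < ∫ x, g x ∂μ := ha.trans_le (le_integral_of_forall_le hg hga)
  have h : ∀ x, c * g x * Real.log (c * g x)
      = c * (g x * Real.log (g x)) + c * Real.log c * g x := by
    intro x
    rw [Real.log_mul hc.ne' (ha.trans_le (hga x)).ne']
    ring
  simp only [realEntropy, h]
  rw [integral_add (((hg.mul (hg.log ha hga)).integrable μ).const_mul c)
    ((hg.integrable μ).const_mul _), integral_const_mul, integral_const_mul, integral_const_mul,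
    Real.log_mul hc.ne' hm.ne']
  ring

end BoundedMeasurable

/-- Tensorization: entropy bounds for the one-coordinate sections add up. -/
theorem realEntropy_pi_le {n : ℕ} (μ : Fin n → Measure ℝ) [∀ i, IsProbabilityMeasure (μ i)]
    {g : (Fin n → ℝ) → ℝ} (hg : IsBddMeasurable g) {a : ℝ} (ha : 0 < a) (hga : ∀ x, a ≤ g x)
    {G : Fin n → (Fin n → ℝ) → ℝ} (hG : ∀ i, IsBddMeasurable (G i))
    (h : ∀ i x, realEntropy (μ i) (fun t => g (Function.update x i t)) ≤
      ∫ t, G i (Function.update x i t) ∂(μ i)) :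
    realEntropy (Measure.pi μ) g ≤ ∑ i, ∫ x, G i x ∂(Measure.pi μ) := by
  induction n with
  | zero =>
    rw [Measure.pi_of_empty μ]
    simp [realEntropy]
  | succ n ih =>
    set π := Measure.pi fun i : Fin n => μ i.succ with hπ
    set e : ℝ × (Fin n → ℝ) → (Fin (n + 1) → ℝ) := fun z => Fin.cons z.1 z.2 with he
    have hmp : MeasurePreserving e ((μ 0).prod π) (Measure.pi μ) := by
      have := (measurePreserving_piFinSuccAbove μ 0).symm
      simpa [MeasurableEquiv.piFinSuccAbove, Fin.insertNthEquiv] using! this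
    have hem : Measurable e := hmp.measurable
    have hint : ∀ {f : (Fin (n + 1) → ℝ) → ℝ}, IsBddMeasurable f →
        ∫ x, f x ∂(Measure.pi μ) = ∫ z, f (e z) ∂((μ 0).prod π) := by
      intro f hf
      rw [← hmp.map_eq, integral_map hem.aemeasurable hf.1.aestronglyMeasurable]
    have hge := hg.comp hem
    have h0 : ∀ y, realEntropy (μ 0) (fun t => g (e (t, y))) ≤ ∫ t, G 0 (e (t, y)) ∂(μ 0) := by
      intro y
      simpa [he] using h 0 (Fin.cons 0 y)
    have hS : ∀ s, realEntropy π (fun y => g (e (s, y))) ≤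
        ∑ i : Fin n, ∫ y, G i.succ (e (s, y)) ∂π := by
      intro s
      refine ih (fun i => μ i.succ) (hge.comp measurable_prodMk_left) (fun y => hga _)
        (G := fun i y => G i.succ (e (s, y)))
        (fun i => ((hG i.succ).comp hem).comp measurable_prodMk_left) fun i y => ?_
      simpa [he, Fin.cons_update] using h i.succ (Fin.cons s y)
    have hE0 : IsBddMeasurable fun y => realEntropy (μ 0) (fun t => g (e (t, y))) :=
      ((hge.mul (hge.log ha fun z => hga _)).integral_fst (μ 0)).sub ((hge.integral_fst (μ 0)).mul
        ((hge.integral_fst (μ 0)).log ha fun y =>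
          le_integral_of_forall_le (hge.comp measurable_prodMk_right) fun x => hga _))
    have hES : IsBddMeasurable fun s => realEntropy π (fun y => g (e (s, y))) :=
      ((hge.mul (hge.log ha fun z => hga _)).integral_snd π).sub ((hge.integral_snd π).mul
        ((hge.integral_snd π).log ha fun y =>
          le_integral_of_forall_le (hge.comp measurable_prodMk_left) fun x => hga _))
    have hGS := fun i : Fin n => ((hG i.succ).comp hem).integral_snd π
    rw [← hmp.map_eq, realEntropy_map hem hg.1, hmp.map_eq, Fin.sum_univ_succ]
    refine (realEntropy_prod_le (μ 0) π hge ha fun z => hga _).trans (add_le_add ?_ ?_)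
    · refine (integral_mono (hE0.integrable π)
        ((((hG 0).comp hem).integral_fst (μ 0)).integrable π) h0).trans_eq ?_
      rw [hint (hG 0), integral_prod_symm _ (((hG 0).comp hem).integrable _)]
    · refine (integral_mono (hES.integrable (μ 0))
        ((IsBddMeasurable.finsetSum Finset.univ fun i _ => hGS i).integrable (μ 0)) hS).trans_eq ?_
      rw [integral_finsetSum _ fun i _ => (hGS i).integrable (μ 0)]
      refine Finset.sum_congr rfl fun i _ => ?_
      rw [hint (hG i.succ), integral_prod _ (((hG i.succ).comp hem).integrable _)]

end SpinSystem

/-! ### The Gaussian logarithmic Sobolev inequality on the line. -/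

namespace SpinSystem

theorem hasDerivAt_integral_Iic {q : ℝ → ℝ} (hq : Continuous q) (hi : Integrable q) (x : ℝ) :
    HasDerivAt (fun y => ∫ t in Set.Iic y, q t) (q x) x := by
  have h : (fun y => ∫ t in Set.Iic y, q t) =
      fun y => (∫ t in Set.Iic (0 : ℝ), q t) + ∫ t in (0 : ℝ)..y, q t := by
    ext y
    rw [← intervalIntegral.integral_Iic_sub_Iic hi.integrableOn hi.integrableOn]
    ring
  rw [h]
  exact (intervalIntegral.integral_hasDerivAt_right (hq.intervalIntegrable _ _)
    (hq.stronglyMeasurableAtFilter _ _) hq.continuousAt).const_add _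

theorem tendsto_integral_Iic_atTop {q : ℝ → ℝ} (hi : Integrable q) :
    Tendsto (fun y => ∫ t in Set.Iic y, q t) atTop (𝓝 (∫ t, q t)) :=
  (aecover_Iic tendsto_id).integral_tendsto_of_countably_generated hi

theorem tendsto_integral_Iic_atBot {q : ℝ → ℝ} (hi : Integrable q) :
    Tendsto (fun y => ∫ t in Set.Iic y, q t) atBot (𝓝 0) := by
  have h : (fun y => ∫ t in Set.Iic y, q t) = fun y => (∫ t, q t) - ∫ t in Set.Ioi y, q t := by
    ext y
    rw [← intervalIntegral.integral_Iic_add_Ioi hi.integrableOn (hi.integrableOn (s := Set.Ioi y))]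
    ring
  rw [h]
  have := (aecover_Ioi (μ := volume) (a := id) (tendsto_id (α := ℝ)
    (x := atBot))).integral_tendsto_of_countably_generated hi
  simpa using this.const_sub (∫ t, q t)

theorem strictMono_integral_Iic {q : ℝ → ℝ} (hq : Continuous q) (hi : Integrable q)
    (hpos : ∀ x, 0 < q x) : StrictMono (fun y => ∫ t in Set.Iic y, q t) :=
  strictMono_of_deriv_pos fun x => by
    rw [(hasDerivAt_integral_Iic hq hi x).deriv]; exact hpos x

/-- Monotone transport between positive continuous densities of the same mass. -/
theorem exists_transport {p f : ℝ → ℝ} (hp : Continuous p) (hpi : Integrable p)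
    (hp0 : ∀ x, 0 < p x) (hf : Continuous f) (hfi : Integrable f) (hf0 : ∀ x, 0 < f x)
    (hpf : ∫ x, p x = ∫ x, f x) :
    ∃ T : ℝ → ℝ, (∀ x, ∫ t in Set.Iic (T x), p t = ∫ t in Set.Iic x, f t) ∧
      ∀ x, HasDerivAt T (f x / p (T x)) x := by
  set P : ℝ → ℝ := fun y => ∫ t in Set.Iic y, p t with hP
  set F : ℝ → ℝ := fun y => ∫ t in Set.Iic y, f t with hF
  have hPm : StrictMono P := strictMono_integral_Iic hp hpi hp0
  have hFm : StrictMono F := strictMono_integral_Iic hf hfi hf0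
  have hPd := hasDerivAt_integral_Iic hp hpi
  have hFd := hasDerivAt_integral_Iic hf hfi
  have hPc : Continuous P := continuous_iff_continuousAt.2 fun x => (hPd x).continuousAt
  have hFc : Continuous F := continuous_iff_continuousAt.2 fun x => (hFd x).continuousAt
  have hF0 : ∀ x, 0 < F x := fun x => by
    have h1 : 0 ≤ F (x - 1) := setIntegral_nonneg measurableSet_Iic fun t _ => (hf0 t).le
    exact h1.trans_lt (hFm (by linarith))
  have hF1 : ∀ x, F x < ∫ t, p t := fun x => by
    have h1 : F (x + 1) ≤ ∫ t, f t :=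
      setIntegral_le_integral hfi (ae_of_all _ fun t => (hf0 t).le)
    rw [hpf]
    exact (hFm (by linarith)).trans_le h1
  -- `F` stays strictly between `0` and the total mass, so the intermediate value theorem provides
  -- `T = P⁻¹ ∘ F`.
  have hex : ∀ x, ∃ y, P y = F x := fun x => by
    obtain ⟨u, hu⟩ := ((tendsto_integral_Iic_atBot hpi).eventually_lt_const (hF0 x)).exists
    obtain ⟨w, hw⟩ := ((tendsto_integral_Iic_atTop hpi).eventually_const_lt (hF1 x)).exists
    exact mem_range_of_exists_le_of_exists_ge hPc ⟨u, hu.le⟩ ⟨w, hw.le⟩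
  choose T hT using hex
  refine ⟨T, hT, fun x => ?_⟩
  have hTm : StrictMono T := fun a b hab => hPm.lt_iff_lt.1 (by rw [hT, hT]; exact hFm hab)
  have hTc : Continuous T := by
    have hinv : ∀ x y, T x < y ↔ F x < P y := fun x y => by rw [← hT x, hPm.lt_iff_lt]
    have hinv' : ∀ x y, y < T x ↔ P y < F x := fun x y => by rw [← hT x, hPm.lt_iff_lt]
    rw [OrderTopology.continuous_iff]
    intro y
    constructor
    · simpa only [Set.preimage, Set.mem_Ioi, hinv'] using isOpen_lt continuous_const hFc
    · simpa only [Set.preimage, Set.mem_Iio, hinv] using isOpen_lt hFc continuous_const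
  have hpT := (hp0 (T x)).ne'
  -- A slope of `T` is a slope of `F` divided by the slope of `P` between `T x` and `T y`.
  -- Continuity and injectivity of `T` send the latter to `p (T x)`.
  have hslope : Tendsto (fun y => slope P (T x) (T y)) (𝓝[≠] x) (𝓝 (p (T x))) := by
    refine (hasDerivAt_iff_tendsto_slope.1 (hPd (T x))).comp ?_
    exact tendsto_nhdsWithin_of_tendsto_nhds_of_eventually_within _
      (hTc.continuousAt.tendsto.mono_left nhdsWithin_le_nhds)
      (eventually_nhdsWithin_of_forall fun y hy => hTm.injective.ne hy)
  rw [hasDerivAt_iff_tendsto_slope]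
  refine ((hasDerivAt_iff_tendsto_slope.1 (hFd x)).div hslope hpT).congr' ?_
  refine eventually_nhdsWithin_of_forall fun y hy => ?_
  have h1 : T y - T x ≠ 0 := sub_ne_zero.2 (hTm.injective.ne hy)
  have h2 : y - x ≠ 0 := sub_ne_zero.2 hy
  have h3 : F y - F x ≠ 0 := sub_ne_zero.2 (hFm.injective.ne hy)
  have h4 : ((fun y => ∫ t in Set.Iic y, f t) : ℝ → ℝ) = F := rfl
  simp only [Pi.div_apply, slope_def_field, hT, h4]
  field_simp

theorem gaussianPDFReal_std (x : ℝ) :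
    gaussianPDFReal 0 1 x = (√(2 * Real.pi))⁻¹ * Real.exp (-x ^ 2 / 2) := by
  simp [gaussianPDFReal]

theorem hasDerivAt_gaussianPDFReal_std (x : ℝ) :
    HasDerivAt (gaussianPDFReal 0 1) (-x * gaussianPDFReal 0 1 x) x := by
  have h : gaussianPDFReal 0 1 = fun x => (√(2 * Real.pi))⁻¹ * Real.exp (-x ^ 2 / 2) :=
    funext gaussianPDFReal_std
  rw [h]
  have h1 : HasDerivAt (fun x : ℝ => -x ^ 2 / 2) (-x) x := by
    have := ((hasDerivAt_pow 2 x).neg).div_const 2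
    convert! this using 1
    norm_num
    ring
  have := h1.exp.const_mul (√(2 * Real.pi))⁻¹
  convert! this using 1
  ring

theorem log_gaussianPDFReal_std (x : ℝ) :
    Real.log (gaussianPDFReal 0 1 x) = Real.log (√(2 * Real.pi))⁻¹ - x ^ 2 / 2 := by
  rw [gaussianPDFReal_std, Real.log_mul (by positivity) (Real.exp_pos _).ne', Real.log_exp]
  ring

/-- After `t ↦ 2t` the density gains the factor `2 exp(-3t²/2)`, which is eventually below `a`. This
keeps the transport map below `2R` at `R`: a density `p g` with `g ≥ a` has at least `a` times the
Gaussian mass beyond `R`. -/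
theorem gaussian_tail_Ioi {a : ℝ} (ha : 0 < a) :
    ∀ᶠ R : ℝ in atTop, ∫ t in Set.Ioi (2 * R), gaussianPDFReal 0 1 t ≤
      a * ∫ t in Set.Ioi R, gaussianPDFReal 0 1 t := by
  have hlim : Tendsto (fun R : ℝ => 2 * Real.exp (-R)) atTop (𝓝 0) := by
    simpa using (Real.tendsto_exp_neg_atTop_nhds_zero).const_mul 2
  filter_upwards [hlim.eventually_lt_const ha, eventually_ge_atTop 1] with R hR hR1
  have hi := integrable_gaussianPDFReal 0 1
  have h := integral_comp_mul_left_Ioi (gaussianPDFReal 0 1) R (b := 2) two_pos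
  rw [smul_eq_mul] at h
  have h3 : ∫ t in Set.Ioi (2 * R), gaussianPDFReal 0 1 t
      = ∫ t in Set.Ioi R, 2 * gaussianPDFReal 0 1 (2 * t) := by
    rw [integral_const_mul, h]; ring
  rw [h3, ← integral_const_mul]
  refine setIntegral_mono_on ((hi.comp_mul_left' two_ne_zero).const_mul 2).integrableOn
    (hi.const_mul a).integrableOn measurableSet_Ioi fun t ht => ?_
  have ht' : R < t := ht
  have h4 : gaussianPDFReal 0 1 (2 * t) = gaussianPDFReal 0 1 t * Real.exp (-(3 * t ^ 2 / 2)) := by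
    rw [gaussianPDFReal_std, gaussianPDFReal_std, mul_assoc, ← Real.exp_add]
    congr 2; ring
  have h5 : Real.exp (-(3 * t ^ 2 / 2)) ≤ Real.exp (-R) := Real.exp_le_exp.2 (by nlinarith)
  have hp := gaussianPDFReal_nonneg 0 1 t
  rw [h4]
  nlinarith [mul_le_mul_of_nonneg_left h5 hp]

theorem gaussian_tail_Iic {a : ℝ} (ha : 0 < a) :
    ∀ᶠ R : ℝ in atTop, ∫ t in Set.Iic (-(2 * R)), gaussianPDFReal 0 1 t ≤
      a * ∫ t in Set.Iic (-R), gaussianPDFReal 0 1 t := by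
  have h : ∀ c : ℝ, ∫ t in Set.Iic (-c), gaussianPDFReal 0 1 t
      = ∫ t in Set.Ioi c, gaussianPDFReal 0 1 t := fun c => by
    rw [← integral_comp_neg_Ioi]
    simp [gaussianPDFReal_std]
  simpa only [h] using gaussian_tail_Ioi ha

theorem tendsto_mul_gaussianPDFReal_std :
    Tendsto (fun R : ℝ => R * gaussianPDFReal 0 1 R) atTop (𝓝 0) := by
  have h1 : Tendsto (fun R : ℝ => (√(2 * Real.pi))⁻¹ * (R ^ 1 * Real.exp (-R))) atTop (𝓝 0) := by
    simpa using (Real.tendsto_pow_mul_exp_neg_atTop_nhds_zero 1).const_mul (√(2 * Real.pi))⁻¹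
  refine tendsto_of_tendsto_of_tendsto_of_le_of_le' tendsto_const_nhds h1 ?_ ?_
  · filter_upwards [eventually_ge_atTop 0] with R hR
    exact mul_nonneg hR (gaussianPDFReal_nonneg _ _ _)
  · filter_upwards [eventually_ge_atTop 2] with R hR
    rw [gaussianPDFReal_std]
    have : Real.exp (-R ^ 2 / 2) ≤ Real.exp (-R) := Real.exp_le_exp.2 (by nlinarith)
    have h2 : 0 ≤ (√(2 * Real.pi))⁻¹ * R := by positivity
    nlinarith [mul_le_mul_of_nonneg_left this h2]

theorem integral_gaussianReal_std (f : ℝ → ℝ) :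
    ∫ x, f x ∂(gaussianReal 0 1) = ∫ x, gaussianPDFReal 0 1 x * f x := by
  simpa using integral_gaussianReal_eq_integral_smul (μ := 0) (v := 1) (f := f) one_ne_zero

theorem integrable_gaussianPDFReal_mul {f : ℝ → ℝ} (hf : IsBddMeasurable f) :
    Integrable (fun x => gaussianPDFReal 0 1 x * f x) :=
  let ⟨C, hC⟩ := hf.2
  (integrable_gaussianPDFReal 0 1).mul_bdd (c := C) hf.1.aestronglyMeasurable (ae_of_all _ hC)

/-- Let `T` transport `p g` to `p`, so `T' = p g / p(T)`, and put `u = T - x`. Then `log g = -x u -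
u² / 2 + log T' ≤ -x u - u² / 2 + u'`. Multiplying by `p g` yields `p g log g ≤ (p g u)' - p g' u -
p g u² / 2`, and completing the square bounds the last two terms by `p g'² / (2g)`. The total
derivative integrates to at most zero in the limit. -/
theorem integral_mul_log_gaussianReal_std_le {g g' : ℝ → ℝ} (hd : ∀ x, HasDerivAt g (g' x) x)
    (hg' : IsBddMeasurable g') {a b : ℝ} (ha : 0 < a) (hga : ∀ x, a ≤ g x) (hgb : ∀ x, g x ≤ b)
    (h1 : ∫ x, g x ∂(gaussianReal 0 1) = 1) :
    ∫ x, g x * Real.log (g x) ∂(gaussianReal 0 1) ≤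
      ∫ x, 1 / 2 * (g' x ^ 2 / g x) ∂(gaussianReal 0 1) := by
  set p := gaussianPDFReal 0 1 with hp
  have hp0 : ∀ x, 0 < p x := fun x => gaussianPDFReal_pos 0 1 x one_ne_zero
  have hpd : ∀ x, HasDerivAt p (-x * p x) x := hasDerivAt_gaussianPDFReal_std
  have hpc : Continuous p := continuous_iff_continuousAt.2 fun x => (hpd x).continuousAt
  have hpi : Integrable p := integrable_gaussianPDFReal 0 1
  have hgc : Continuous g := continuous_iff_continuousAt.2 fun x => (hd x).continuousAt
  have hg0 : ∀ x, 0 < g x := fun x => ha.trans_le (hga x)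
  have hgB : IsBddMeasurable g := .of_mem_Icc hgc.measurable fun x => ⟨hga x, hgb x⟩
  have hgi : IsBddMeasurable fun x => (g x)⁻¹ :=
    .of_mem_Icc hgc.measurable.inv (a := 0) (b := a⁻¹) fun x =>
      ⟨(inv_pos.2 (hg0 x)).le, inv_anti₀ ha (hga x)⟩
  have hfi : Integrable fun x => p x * g x := integrable_gaussianPDFReal_mul hgB
  have hE : IsBddMeasurable fun x => g x * Real.log (g x) := hgB.mul (hgB.log ha hga)
  have hI : IsBddMeasurable fun x => 1 / 2 * (g' x ^ 2 / g x) := by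
    simpa only [div_eq_mul_inv, pow_two] using (IsBddMeasurable.const _).mul ((hg'.mul hg').mul hgi)
  have hb : 0 < b := (hg0 0).trans_le (hgb 0)
  rw [integral_gaussianReal_std, ← hp] at h1
  have hp1 : ∫ x, p x = 1 := integral_gaussianPDFReal_eq_one 0 one_ne_zero
  obtain ⟨T, hT, hTd⟩ := exists_transport hpc hpi hp0 (hpc.mul hgc) hfi
    (fun x => mul_pos (hp0 x) (hg0 x)) (hp1.trans h1.symm)
  have hmono := strictMono_integral_Iic hpc hpi hp0
  -- the boundary terms vanish at infinity
  have hlow : ∀ᶠ R : ℝ in atTop, -(2 * R) ≤ T (-R) := by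
    filter_upwards [gaussian_tail_Iic ha] with R hR
    refine hmono.le_iff_le.1 ?_
    simp only [hT, Pi.mul_apply]
    rw [← hp] at hR
    refine hR.trans ?_
    rw [← integral_const_mul]
    refine setIntegral_mono_on (hpi.const_mul a).integrableOn hfi.integrableOn measurableSet_Iic
      fun t _ => ?_
    rw [mul_comm]
    exact mul_le_mul_of_nonneg_left (hga t) (hp0 t).le
  have hup : ∀ᶠ R : ℝ in atTop, T R ≤ 2 * R := by
    filter_upwards [gaussian_tail_Ioi ha] with R hR
    refine hmono.le_iff_le.1 ?_
    simp only [hT, Pi.mul_apply]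
    rw [← hp] at hR
    have e1 := intervalIntegral.integral_Iic_add_Ioi (b := 2 * R) hpi.integrableOn hpi.integrableOn
    have e2 := intervalIntegral.integral_Iic_add_Ioi (b := R) hfi.integrableOn hfi.integrableOn
    have e3 : a * ∫ t in Set.Ioi R, p t ≤ ∫ t in Set.Ioi R, p t * g t := by
      rw [← integral_const_mul]
      refine setIntegral_mono_on (hpi.const_mul a).integrableOn hfi.integrableOn measurableSet_Ioi
        fun t _ => ?_
      rw [mul_comm]
      exact mul_le_mul_of_nonneg_left (hga t) (hp0 t).le
    linarith
  set H : ℝ → ℝ := fun x => g x * p x * (T x - x) with hH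
  have hHd : ∀ x, HasDerivAt H ((g' x * p x + g x * (-x * p x)) * (T x - x) +
      g x * p x * (p x * g x / p (T x) - 1)) x := fun x =>
    ((hd x).mul (hpd x)).mul ((hTd x).sub (hasDerivAt_id x))
  have hHc : Continuous H := continuous_iff_continuousAt.2 fun x => (hHd x).continuousAt
  set k : ℝ → ℝ := fun x => p x * (g x * Real.log (g x) - 1 / 2 * (g' x ^ 2 / g x)) with hk
  have hki : Integrable k := integrable_gaussianPDFReal_mul (hE.sub hI)
  have hle : ∀ x, k x ≤ (g' x * p x + g x * (-x * p x)) * (T x - x) +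
      g x * p x * (p x * g x / p (T x) - 1) := fun x => by
    have hgx := hg0 x
    have hpx := hp0 x
    have hpT := hp0 (T x)
    have hlog := Real.log_le_sub_one_of_pos (x := p x * g x / p (T x)) (by positivity)
    rw [Real.log_div (by positivity) hpT.ne', Real.log_mul hpx.ne' hgx.ne', hp,
      log_gaussianPDFReal_std, log_gaussianPDFReal_std, ← hp] at hlog
    have h2 := mul_le_mul_of_nonneg_left hlog (mul_pos hgx hpx).le
    -- The square that absorbs the cross term `p g' (T - x)`.
    have h3 : 0 ≤ 1 / 2 * (p x * g x) * (T x - x + g' x / g x) ^ 2 := by positivity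
    have h4 : 1 / 2 * (p x * g x) * (T x - x + g' x / g x) ^ 2 = 1 / 2 * (p x * g x) * (T x - x) ^ 2
        + p x * g' x * (T x - x) + p x * (1 / 2 * (g' x ^ 2 / g x)) := by
      field_simp
      ring
    simp only [hk]
    nlinarith [h2, h3, h4]
  -- `H R - H (-R)` need only be bounded above, so one-sided control of `T` at each end suffices.
  -- The comparison form of the fundamental theorem requires integrability of `k` only, not of the
  -- derivative of `H`.
  have hbd : ∀ᶠ R : ℝ in atTop, ∫ x in (-R)..R, k x ≤ 2 * b * (R * p R) := by
    filter_upwards [hlow, hup, eventually_ge_atTop 0] with R hl hu hR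
    have hpe : p (-R) = p R := by simp [hp, gaussianPDFReal_std]
    refine (intervalIntegral.integral_le_sub_of_hasDeriv_right_of_le (by linarith)
      hHc.continuousOn (fun x _ => (hHd x).hasDerivWithinAt) hki.integrableOn
      fun x _ => hle x).trans ?_
    have h5 : H R ≤ b * (R * p R) := by
      have : g R * p R * (T R - R) ≤ g R * p R * R :=
        mul_le_mul_of_nonneg_left (by linarith) (mul_pos (hg0 R) (hp0 R)).le
      have h6 : g R * (p R * R) ≤ b * (p R * R) :=
        mul_le_mul_of_nonneg_right (hgb R) (mul_nonneg (hp0 R).le hR)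
      simp only [hH]; nlinarith
    have h7 : -H (-R) ≤ b * (R * p R) := by
      have : g (-R) * p R * (-R - T (-R)) ≤ g (-R) * p R * R :=
        mul_le_mul_of_nonneg_left (by linarith) (mul_pos (hg0 _) (hp0 R)).le
      have h6 : g (-R) * (p R * R) ≤ b * (p R * R) :=
        mul_le_mul_of_nonneg_right (hgb _) (mul_nonneg (hp0 R).le hR)
      simp only [hH, hpe]; nlinarith
    linarith
  have hlim := intervalIntegral_tendsto_integral hki tendsto_neg_atTop_atBot tendsto_id
  have hk0 : ∫ x, k x ≤ 0 := by
    refine le_of_tendsto_of_tendsto hlim ?_ hbd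
    simpa using tendsto_mul_gaussianPDFReal_std.const_mul (2 * b)
  have hsplit : ∫ x, k x = (∫ x, p x * (g x * Real.log (g x))) -
      ∫ x, p x * (1 / 2 * (g' x ^ 2 / g x)) := by
    simp only [hk, mul_sub, hp]
    exact integral_sub (integrable_gaussianPDFReal_mul hE) (integrable_gaussianPDFReal_mul hI)
  rw [integral_gaussianReal_std, integral_gaussianReal_std, ← hp]
  linarith

/-- The logarithmic Sobolev inequality of the standard Gaussian measure on the line. -/
theorem realEntropy_gaussianReal_std_le {g g' : ℝ → ℝ} (hd : ∀ x, HasDerivAt g (g' x) x)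
    (hg' : IsBddMeasurable g') {a b : ℝ} (ha : 0 < a) (hga : ∀ x, a ≤ g x) (hgb : ∀ x, g x ≤ b) :
    realEntropy (gaussianReal 0 1) g ≤ ∫ x, 1 / 2 * (g' x ^ 2 / g x) ∂(gaussianReal 0 1) := by
  have hgc : Continuous g := continuous_iff_continuousAt.2 fun x => (hd x).continuousAt
  have hgB : IsBddMeasurable g := .of_mem_Icc hgc.measurable fun x => ⟨hga x, hgb x⟩
  set m := ∫ x, g x ∂(gaussianReal 0 1) with hm
  have hm0 : 0 < m := ha.trans_le (le_integral_of_forall_le hgB hga)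
  have h := integral_mul_log_gaussianReal_std_le (g := fun x => m⁻¹ * g x)
    (g' := fun x => m⁻¹ * g' x) (fun x => (hd x).const_mul m⁻¹) ((IsBddMeasurable.const _).mul hg')
    (a := m⁻¹ * a) (b := m⁻¹ * b) (by positivity)
    (fun x => mul_le_mul_of_nonneg_left (hga x) (by positivity))
    (fun x => mul_le_mul_of_nonneg_left (hgb x) (by positivity))
    (by rw [integral_const_mul, ← hm, inv_mul_cancel₀ hm0.ne'])
  have h2 := realEntropy_const_mul (μ := gaussianReal 0 1) hgB ha hga (inv_pos.2 hm0)
  rw [realEntropy, integral_const_mul, ← hm, inv_mul_cancel₀ hm0.ne', Real.log_one, mul_zero,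
    sub_zero] at h2
  rw [h2] at h
  have h3 : ∀ x, 1 / 2 * ((m⁻¹ * g' x) ^ 2 / (m⁻¹ * g x)) = m⁻¹ * (1 / 2 * (g' x ^ 2 / g x)) :=
    fun x => by
      have := (ha.trans_le (hga x)).ne'
      field_simp
  simp only [h3] at h
  rw [integral_const_mul] at h
  exact le_of_mul_le_mul_left h (inv_pos.2 hm0)

/-- The logarithmic Sobolev inequality of a Gaussian measure on the line. -/
theorem realEntropy_gaussianReal_le (m : ℝ) (v : NNReal) {g g' : ℝ → ℝ}
    (hd : ∀ x, HasDerivAt g (g' x) x) (hg' : IsBddMeasurable g') {a b : ℝ} (ha : 0 < a)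
    (hga : ∀ x, a ≤ g x) (hgb : ∀ x, g x ≤ b) :
    realEntropy (gaussianReal m v) g ≤ ∫ x, v / 2 * (g' x ^ 2 / g x) ∂(gaussianReal m v) := by
  have hgc : Continuous g := continuous_iff_continuousAt.2 fun x => (hd x).continuousAt
  set e : ℝ → ℝ := fun x => √v * x + m with he
  have hem : Measurable e := by fun_prop
  have hmap : (gaussianReal 0 1).map e = gaussianReal m v := by
    have h3 : NNReal.mk (√v ^ 2) (sq_nonneg _) * 1 = v := by
      ext; simp
    have h1 := gaussianReal_map_const_mul (μ := 0) (v := 1) (√v)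
    rw [h3, mul_zero] at h1
    have h2 := gaussianReal_map_add_const (μ := 0) (v := v) m
    rw [← h1, Measure.map_map (by fun_prop) (by fun_prop), zero_add] at h2
    exact h2
  have hed : ∀ x, HasDerivAt e (√v) x := fun x => by
    simpa [he] using! ((hasDerivAt_id x).const_mul (√v)).add_const m
  rw [← hmap, realEntropy_map hem hgc.measurable, integral_map hem.aemeasurable (by
    exact (((hg'.1.pow_const 2).div hgc.measurable).const_mul _).aestronglyMeasurable)]
  refine (realEntropy_gaussianReal_std_le (g' := fun x => g' (e x) * √v)
    (fun x => (hd (e x)).comp x (hed x)) ((hg'.comp hem).mul (.const _)) ha (fun x => hga _)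
    fun x => hgb _).trans_eq ?_
  congr 1 with x
  rw [mul_pow, Real.sq_sqrt v.coe_nonneg, Function.comp_apply]
  ring

end SpinSystem

/-! ### Quadratic potentials and Gaussian products. -/

namespace SpinSystem

theorem pi_tilted {n : ℕ} (w : Fin n → ℝ → ℝ) (hw : ∀ i, Integrable fun t => Real.exp (w i t)) :
    Measure.pi (fun i => (volume : Measure ℝ).tilted (w i)) =
      (volume : Measure (Fin n → ℝ)).tilted fun x => ∑ i, w i (x i) := by
  have := fun i => isProbabilityMeasure_tilted (hw i)
  refine Measure.pi_eq fun s hs => ?_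
  simp only [tilted_apply_eq_ofReal_integral]
  rw [← ENNReal.ofReal_prod_of_nonneg fun i _ => integral_nonneg fun t => by positivity]
  congr 1
  have h : ∀ x : Fin n → ℝ, Real.exp (∑ i, w i (x i)) / ∫ x : Fin n → ℝ, Real.exp (∑ i, w i (x i))
      = ∏ i, (Real.exp (w i (x i)) / ∫ t, Real.exp (w i t)) := fun x => by
    simp only [Real.exp_sum]
    rw [integral_fintype_prod_volume_eq_prod (fun i t => Real.exp (w i t)), Finset.prod_div_distrib]
  simp only [h]
  rw [volume_pi, Measure.restrict_pi_pi,
    integral_fintype_prod_eq_prod (fun i t => Real.exp (w i t) / ∫ t, Real.exp (w i t))]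

theorem integrable_exp_neg_sub_sq_div (m : ℝ) {v : NNReal} (hv : v ≠ 0) :
    Integrable fun t => Real.exp (-(t - m) ^ 2 / (2 * v)) := by
  have h := (integrable_gaussianPDFReal m v).const_mul √(2 * Real.pi * v)
  have hv0 : (0 : ℝ) < v := by positivity
  refine h.congr (ae_of_all _ fun t => ?_)
  simp only [gaussianPDFReal]
  rw [mul_inv_cancel_left₀ (by positivity)]

theorem gaussianReal_eq_tilted (m : ℝ) {v : NNReal} (hv : v ≠ 0) :
    gaussianReal m v = (volume : Measure ℝ).tilted fun t => -(t - m) ^ 2 / (2 * v) := by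
  have hv0 : (0 : ℝ) < v := by positivity
  have h1 := integral_gaussianPDFReal_eq_one m hv
  simp only [gaussianPDFReal] at h1
  rw [integral_const_mul] at h1
  have h2 : ∫ t, Real.exp (-(t - m) ^ 2 / (2 * v)) = √(2 * Real.pi * v) := by
    field_simp at h1
    simpa [neg_div] using h1
  rw [gaussianReal_of_var_ne_zero _ hv, Measure.tilted]
  congr 1 with t
  rw [gaussianPDF, gaussianPDFReal, h2, div_eq_inv_mul _ √(2 * Real.pi * v)]

theorem map_tilted {α β : Type*} [MeasurableSpace α] [MeasurableSpace β] {μ : Measure α}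
    {ν : Measure β} {e : α → β} (he : MeasurePreserving e μ ν) (hm : MeasurableEmbedding e)
    (w : β → ℝ) : (μ.tilted fun x => w (e x)).map e = ν.tilted w := by
  ext s hs
  rw [Measure.map_apply he.measurable hs, tilted_apply' _ _ (he.measurable hs),
    tilted_apply' _ _ hs, he.integral_comp hm (fun y => Real.exp (w y)),
    ← he.setLIntegral_comp_preimage_emb hm]

theorem tilted_add_const {α : Type*} [MeasurableSpace α] (μ : Measure α) (w : α → ℝ) (c : ℝ) :
    μ.tilted (fun x => w x + c) = μ.tilted w := by
  simp only [Measure.tilted, Real.exp_add, integral_mul_const,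
    mul_div_mul_right _ _ (Real.exp_pos c).ne']

section

variable {ι : Type*} [Fintype ι]

/-- `U` is a quadratic polynomial whose quadratic part is at least `α ‖x‖²`. -/
def IsQuadratic (α : ℝ) (U : EuclideanSpace ℝ ι → ℝ) : Prop :=
  ∃ (A : EuclideanSpace ℝ ι →ₗ[ℝ] EuclideanSpace ℝ ι) (b : EuclideanSpace ℝ ι) (c : ℝ),
    A.IsSymmetric ∧ (∀ x, α * ‖x‖ ^ 2 ≤ ⟪A x, x⟫_ℝ) ∧ ∀ x, U x = ⟪A x, x⟫_ℝ + ⟪b, x⟫_ℝ + c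

namespace IsQuadratic

theorem add {α β : ℝ} {U V : EuclideanSpace ℝ ι → ℝ} (hU : IsQuadratic α U)
    (hV : IsQuadratic β V) : IsQuadratic (α + β) (fun x => U x + V x) := by
  obtain ⟨A, b, c, hA, hA', h⟩ := hU
  obtain ⟨A₂, b₂, c₂, hA₂, hA₂', h₂⟩ := hV
  refine ⟨A + A₂, b + b₂, c + c₂, hA.add hA₂, fun x => ?_, fun x => ?_⟩
  · rw [LinearMap.add_apply, inner_add_left, add_mul]
    exact add_le_add (hA' x) (hA₂' x)
  · simp only [LinearMap.add_apply, inner_add_left, h, h₂]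
    ring

theorem const_mul {U : EuclideanSpace ℝ ι → ℝ} (hU : IsQuadratic 0 U) {r : ℝ} (hr : 0 ≤ r) :
    IsQuadratic 0 (fun x => r * U x) := by
  obtain ⟨A, b, c, hA, hA', h⟩ := hU
  refine ⟨r • A, r • b, r * c, hA.smul (by simp), fun x => ?_, fun x => ?_⟩
  · rw [LinearMap.smul_apply, real_inner_smul_left, zero_mul]
    exact mul_nonneg hr (by simpa using hA' x)
  · simp only [LinearMap.smul_apply, real_inner_smul_left, h]
    ring

theorem finsetSum {κ : Type*} (s : Finset κ) {U : κ → EuclideanSpace ℝ ι → ℝ}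
    (hU : ∀ k, IsQuadratic 0 (U k)) : IsQuadratic 0 (fun x => ∑ k ∈ s, U k x) := by
  classical
  induction s using Finset.induction_on with
  | empty => exact ⟨0, 0, 0, fun x y => by simp, by simp, by simp⟩
  | insert k s hk ih => simpa only [Finset.sum_insert hk, add_zero] using (hU k).add ih

/-- The quadratic part is the nonnegative rank one form `⟪l, x⟫²`; the shift `c` affects only lower
order terms. This is why boundary values cost nothing. -/
theorem inner_sub_sq (l : EuclideanSpace ℝ ι) (c : ℝ) :
    IsQuadratic 0 (fun x => (⟪l, x⟫_ℝ - c) ^ 2) := by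
  refine ⟨(innerₛₗ ℝ l).smulRight l, -(2 * c) • l, c ^ 2, fun x y => ?_, fun x => ?_, fun x => ?_⟩
  · simp [real_inner_smul_right, real_inner_comm, mul_comm]
  · simp [real_inner_smul_left, mul_self_nonneg]
  · simp [real_inner_smul_left]
    ring

theorem mul_norm_sq (α : ℝ) : IsQuadratic α (fun x : EuclideanSpace ℝ ι => α * ‖x‖ ^ 2) := by
  refine ⟨α • LinearMap.id, 0, 0, LinearMap.IsSymmetric.id.smul (by simp), fun x => ?_,
    fun x => ?_⟩ <;> simp [real_inner_smul_left]

end IsQuadratic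

/-- The coordinates attached to an orthonormal basis. -/
noncomputable def coordEquiv {n : ℕ} (e : OrthonormalBasis (Fin n) ℝ (EuclideanSpace ℝ ι)) :
    (Fin n → ℝ) ≃L[ℝ] EuclideanSpace ℝ ι :=
  (PiLp.continuousLinearEquiv 2 ℝ (fun _ : Fin n => ℝ)).symm.trans
    e.repr.symm.toContinuousLinearEquiv

theorem repr_coordEquiv {n : ℕ} (e : OrthonormalBasis (Fin n) ℝ (EuclideanSpace ℝ ι))
    (y : Fin n → ℝ) (i : Fin n) : e.repr (coordEquiv e y) i = y i := by
  simp [coordEquiv]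

theorem coordEquiv_single {n : ℕ} (e : OrthonormalBasis (Fin n) ℝ (EuclideanSpace ℝ ι))
    (i : Fin n) : coordEquiv e (Pi.single i 1) = e i := by
  apply e.repr.injective
  ext j
  rw [repr_coordEquiv, e.repr_self]
  simp [Pi.single_apply]

theorem measurePreserving_coordEquiv {n : ℕ}
    (e : OrthonormalBasis (Fin n) ℝ (EuclideanSpace ℝ ι)) :
    MeasurePreserving (coordEquiv e) volume volume :=
  e.measurePreserving_repr_symm.comp (PiLp.volume_preserving_toLp (Fin n))

theorem measurableEmbedding_coordEquiv {n : ℕ}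
    (e : OrthonormalBasis (Fin n) ℝ (EuclideanSpace ℝ ι)) : MeasurableEmbedding (coordEquiv e) :=
  (coordEquiv e).toHomeomorph.measurableEmbedding

/-- A Gibbs measure with quadratic potential is a product of Gaussian measures in suitable
orthonormal coordinates. -/
theorem IsQuadratic.exists_gibbsMeasure_eq_map {α : ℝ} (hα : 0 < α) {U : EuclideanSpace ℝ ι → ℝ}
    (hU : IsQuadratic α U) :
    ∃ (n : ℕ) (e : OrthonormalBasis (Fin n) ℝ (EuclideanSpace ℝ ι)) (m : Fin n → ℝ)
      (v : Fin n → NNReal), (∀ i, (v i : ℝ) ≤ 1 / (2 * α)) ∧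
      gibbsMeasure U = (Measure.pi fun i => gaussianReal (m i) (v i)).map (coordEquiv e) := by
  obtain ⟨A, b, c, hA, hAα, hUx⟩ := hU
  set e := hA.eigenvectorBasis rfl with he
  set l := hA.eigenvalues rfl with hl
  have hlα : ∀ i, α ≤ l i := fun i => by
    have h := hAα (e i)
    rw [he, hA.apply_eigenvectorBasis rfl i, ← he, ← hl] at h
    simpa [real_inner_smul_left] using h
  have hl0 : ∀ i, 0 < l i := fun i => hα.trans_le (hlα i)
  set β := e.repr b with hβ
  -- Completing the square, `l y² + β y = l (y + β / (2l))² - β² / (4l)`, gives mean `-β / (2l)` and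
  -- variance `1 / (2l)`. The leftover constant disappears in the normalization.
  refine ⟨_, e, fun i => -β i / (2 * l i), fun i => (1 / (2 * l i)).toNNReal, fun i => ?_, ?_⟩
  · rw [Real.coe_toNNReal _ (one_div_pos.2 (mul_pos two_pos (hl0 i))).le]
    exact one_div_le_one_div_of_le (by positivity) (by linarith [hlα i])
  · have hpos : ∀ i, 0 < 1 / (2 * l i) := fun i => one_div_pos.2 (mul_pos two_pos (hl0 i))
    have hv : ∀ i, (1 / (2 * l i)).toNNReal ≠ 0 := fun i => by
      simpa using hl0 i
    simp only [gaussianReal_eq_tilted _ (hv _)]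
    rw [pi_tilted _ fun i => integrable_exp_neg_sub_sq_div _ (hv i), gibbsMeasure, ← map_tilted (measurePreserving_coordEquiv e)
      (measurableEmbedding_coordEquiv e)]
    congr 1
    rw [← tilted_add_const _ _ (c - ∑ i, β i ^ 2 / (4 * l i))]
    congr 1
    ext y
    have h1 : ⟪A (coordEquiv e y), coordEquiv e y⟫_ℝ = ∑ i, l i * y i ^ 2 := by
      rw [← e.repr.inner_map_map, PiLp.inner_apply]
      refine Finset.sum_congr rfl fun i _ => ?_
      have h2 := hA.eigenvectorBasis_apply_self_apply rfl (coordEquiv e y) i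
      rw [← he, repr_coordEquiv, ← hl] at h2
      rw [h2, repr_coordEquiv]
      simp
      ring
    have h2 : ⟪b, coordEquiv e y⟫_ℝ = ∑ i, β i * y i := by
      rw [← e.repr.inner_map_map, PiLp.inner_apply]
      refine Finset.sum_congr rfl fun i _ => ?_
      rw [repr_coordEquiv]
      simp [hβ, mul_comm]
    rw [hUx, h1, h2, ← sub_eq_zero]
    have h3 : ∀ i, -(y i - -β i / (2 * l i)) ^ 2 / (2 * ((1 / (2 * l i)).toNNReal : ℝ))
        = -(l i * y i ^ 2) - β i * y i - β i ^ 2 / (4 * l i) := fun i => by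
      have := (hl0 i).ne'
      rw [Real.coe_toNNReal _ (hpos i).le]
      field_simp
      ring
    simp only [h3, Finset.sum_sub_distrib, Finset.sum_neg_distrib]
    ring

theorem IsQuadratic.isProbabilityMeasure {α : ℝ} (hα : 0 < α) {U : EuclideanSpace ℝ ι → ℝ}
    (hU : IsQuadratic α U) : IsProbabilityMeasure (gibbsMeasure U) := by
  obtain ⟨n, e, m, v, -, h⟩ := hU.exists_gibbsMeasure_eq_map hα
  rw [h]
  exact Measure.isProbabilityMeasure_map (coordEquiv e).continuous.measurable.aemeasurable

namespace IsTestFunction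

variable {f : EuclideanSpace ℝ ι → ℝ}

theorem differentiable (hf : IsTestFunction f) : Differentiable ℝ f :=
  hf.1.differentiable (by simp)

theorem isBddMeasurable (hf : IsTestFunction f) : IsBddMeasurable f :=
  let ⟨C, hC⟩ := hf.2.exists_bound_of_continuous hf.1.continuous
  ⟨hf.1.continuous.measurable, C, hC⟩

theorem continuous_gradient (hf : IsTestFunction f) : Continuous (gradient f) :=
  (InnerProductSpace.toDual ℝ _).symm.continuous.comp (hf.1.continuous_fderiv (by simp))

theorem exists_norm_gradient_le (hf : IsTestFunction f) : ∃ C, ∀ x, ‖gradient f x‖ ≤ C := by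
  obtain ⟨C, hC⟩ := (hf.2.fderiv (𝕜 := ℝ)).exists_bound_of_continuous
    (hf.1.continuous_fderiv (by simp))
  exact ⟨C, fun x => by simpa [gradient] using hC x⟩

theorem isBddMeasurable_norm_gradient (hf : IsTestFunction f) :
    IsBddMeasurable (fun x => ‖gradient f x‖) :=
  let ⟨C, hC⟩ := hf.exists_norm_gradient_le
  ⟨hf.continuous_gradient.norm.measurable, C, fun x => by simpa using hC x⟩

theorem isBddMeasurable_inner_gradient (hf : IsTestFunction f) (w : EuclideanSpace ℝ ι) :
    IsBddMeasurable (fun x => ⟪gradient f x, w⟫_ℝ) := by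
  obtain ⟨C, hC⟩ := hf.exists_norm_gradient_le
  refine ⟨(hf.continuous_gradient.inner continuous_const).measurable, C * ‖w‖, fun x => ?_⟩
  exact (abs_real_inner_le_norm _ _).trans (mul_le_mul_of_nonneg_right (hC x) (norm_nonneg _))

end IsTestFunction

/-! ### The logarithmic Sobolev inequality for test functions. -/

/-- The logarithmic Sobolev inequality for `√(f² + ε)`. -/
theorem IsQuadratic.realEntropy_add_const_le {α : ℝ} (hα : 0 < α) {U : EuclideanSpace ℝ ι → ℝ}
    (hU : IsQuadratic α U) {f : EuclideanSpace ℝ ι → ℝ} (hf : IsTestFunction f) {ε : ℝ}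
    (hε : 0 < ε) :
    realEntropy (gibbsMeasure U) (fun x => f x ^ 2 + ε) ≤
      1 / α * ∫ x, ‖gradient f x‖ ^ 2 ∂(gibbsMeasure U) := by
  obtain ⟨n, e, m, v, hv, hμ⟩ := hU.exists_gibbsMeasure_eq_map hα
  set Ψ := coordEquiv e with hΨ
  have hΨm : Measurable Ψ := Ψ.continuous.measurable
  have hfB := hf.isBddMeasurable
  have hg : IsBddMeasurable fun x => f x ^ 2 + ε := by
    simpa only [pow_two] using (hfB.mul hfB).add (.const ε)
  have hgε : ∀ x, ε ≤ f x ^ 2 + ε := fun x => by nlinarith [sq_nonneg (f x)]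
  obtain ⟨C, hC⟩ := hg.2
  have hgi : IsBddMeasurable fun x => (f x ^ 2 + ε)⁻¹ :=
    .of_mem_Icc hg.1.inv (a := 0) (b := ε⁻¹) fun x =>
      ⟨inv_nonneg.2 (hε.le.trans (hgε x)), inv_anti₀ hε (hgε x)⟩
  set D : Fin n → EuclideanSpace ℝ ι → ℝ := fun i x => 2 * f x * ⟪gradient f x, e i⟫_ℝ with hD
  have hDB : ∀ i, IsBddMeasurable (D i) := fun i =>
    ((IsBddMeasurable.const 2).mul hfB).mul (hf.isBddMeasurable_inner_gradient (e i))
  set G : Fin n → EuclideanSpace ℝ ι → ℝ := fun i x => v i / 2 * (D i x ^ 2 / (f x ^ 2 + ε)) with hG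
  have hGB : ∀ i, IsBddMeasurable (G i) := fun i => by
    simpa only [hG, div_eq_mul_inv, pow_two] using
      (IsBddMeasurable.const _).mul (((hDB i).mul (hDB i)).mul (by simpa only [pow_two] using hgi))
  have hderiv : ∀ i y t, HasDerivAt (fun t => f (Ψ (Function.update y i t)) ^ 2 + ε)
      (D i (Ψ (Function.update y i t))) t := fun i y t => by
    have h1 : HasDerivAt (fun t => Ψ (Function.update y i t)) (e i) t := by
      have := (Ψ : (Fin n → ℝ) →L[ℝ] EuclideanSpace ℝ ι).hasFDerivAt.comp_hasDerivAt t
        (hasDerivAt_update y i t)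
      simpa [hΨ, coordEquiv_single] using! this
    have h2 := (hf.differentiable (Ψ (Function.update y i t))).hasGradientAt.hasFDerivAt
    have h3 := ((h2.comp_hasDerivAt t h1).pow 2).add_const ε
    convert! h3 using 1
    simp [hD]
  have hpi := realEntropy_pi_le (fun i => gaussianReal (m i) (v i)) (hg.comp hΨm) hε
    (fun y => hgε (Ψ y)) (G := fun i y => G i (Ψ y)) (fun i => (hGB i).comp hΨm) fun i y =>
      realEntropy_gaussianReal_le (m i) (v i) (hderiv i y)
        ((hDB i).comp (hΨm.comp (measurable_update y))) hε (fun t => hgε _)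
        fun t => (le_abs_self _).trans (hC _)
  have hgr := hf.isBddMeasurable_norm_gradient
  have hgr2 : IsBddMeasurable fun x => 1 / α * ‖gradient f x‖ ^ 2 := by
    simpa only [pow_two] using (IsBddMeasurable.const _).mul (hgr.mul hgr)
  have hsum : ∀ x, ∑ i, G i x ≤ 1 / α * ‖gradient f x‖ ^ 2 := fun x => by
    -- Since `f² / (f² + ε) ≤ 1`, the quotient is at most `4 ⟪∇f, e i⟫²`, and `4 v / 2 ≤ 1 / α`.
    -- Parseval then sums over `i`.
    have h1 : ∀ i, G i x ≤ 1 / α * ⟪gradient f x, e i⟫_ℝ ^ 2 := fun i => by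
      have h2 : D i x ^ 2 / (f x ^ 2 + ε) ≤ 4 * ⟪gradient f x, e i⟫_ℝ ^ 2 := by
        rw [div_le_iff₀ (hε.trans_le (hgε x))]
        simp only [hD]
        nlinarith [mul_nonneg hε.le (sq_nonneg ⟪gradient f x, e i⟫_ℝ)]
      have h3 : (v i : ℝ) / 2 * 4 ≤ 1 / α := by
        have h5 : 1 / α = 1 / (2 * α) * 2 := by field_simp
        rw [h5]
        linarith [hv i]
      calc G i x ≤ v i / 2 * (4 * ⟪gradient f x, e i⟫_ℝ ^ 2) :=
            mul_le_mul_of_nonneg_left h2 (by positivity)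
        _ = v i / 2 * 4 * ⟪gradient f x, e i⟫_ℝ ^ 2 := by ring
        _ ≤ _ := mul_le_mul_of_nonneg_right h3 (sq_nonneg _)
    refine (Finset.sum_le_sum fun i _ => h1 i).trans_eq ?_
    rw [← Finset.mul_sum]
    congr 1
    simpa using e.sum_sq_norm_inner_left (gradient f x)
  rw [hμ, realEntropy_map hΨm hg.1]
  refine hpi.trans ?_
  rw [← integral_finsetSum _ fun i _ => ((hGB i).comp hΨm).integrable _, ← integral_const_mul,
    integral_map hΨm.aemeasurable hgr2.1.aestronglyMeasurable]
  exact integral_mono ((IsBddMeasurable.finsetSum Finset.univ fun i _ =>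
    (hGB i).comp hΨm).integrable _) ((hgr2.comp hΨm).integrable _) fun y => hsum (Ψ y)

/-- The logarithmic Sobolev inequality for test functions. -/
theorem IsQuadratic.realEntropy_sq_le {α : ℝ} (hα : 0 < α) {U : EuclideanSpace ℝ ι → ℝ}
    (hU : IsQuadratic α U) {f : EuclideanSpace ℝ ι → ℝ} (hf : IsTestFunction f) :
    realEntropy (gibbsMeasure U) (fun x => f x ^ 2) ≤
      1 / α * ∫ x, ‖gradient f x‖ ^ 2 ∂(gibbsMeasure U) := by
  have := hU.isProbabilityMeasure hα
  set μ := gibbsMeasure U with hμ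
  have hfB := hf.isBddMeasurable
  have hf2 : IsBddMeasurable fun x => f x ^ 2 := by simpa only [pow_two] using hfB.mul hfB
  obtain ⟨C, hC⟩ := hf2.2
  -- As `ε n ≤ 1`, all values of `f² + ε n` lie in `[0, C + 1]`, where `t log t` is bounded; `K` is
  -- the dominating constant.
  obtain ⟨K, hK⟩ := (isCompact_Icc (a := (0 : ℝ)) (b := C + 1)).exists_bound_of_continuousOn
    Real.continuous_mul_log.continuousOn
  set ε : ℕ → ℝ := fun n => 1 / ((n : ℝ) + 1) with hε
  have hε0 : ∀ n, 0 < ε n := fun n => Nat.one_div_pos_of_nat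
  have hε1 : ∀ n, ε n ≤ 1 := fun n => by
    have : (0 : ℝ) ≤ n := n.cast_nonneg
    exact div_le_one_of_le₀ (by linarith) (by linarith)
  have hεt : Tendsto ε atTop (𝓝 0) := tendsto_one_div_add_atTop_nhds_zero_nat
  have hmem : ∀ n x, f x ^ 2 + ε n ∈ Set.Icc 0 (C + 1) := fun n x =>
    ⟨by have := hε0 n; positivity, add_le_add ((le_abs_self _).trans (hC x)) (hε1 n)⟩
  have hpt : ∀ x, Tendsto (fun n => f x ^ 2 + ε n) atTop (𝓝 (f x ^ 2)) := fun x => by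
    simpa using hεt.const_add (f x ^ 2)
  have h1 : Tendsto (fun n => ∫ x, (f x ^ 2 + ε n) * Real.log (f x ^ 2 + ε n) ∂μ) atTop
      (𝓝 (∫ x, f x ^ 2 * Real.log (f x ^ 2) ∂μ)) :=
    tendsto_integral_of_dominated_convergence (fun _ => K)
      (fun n => (Real.continuous_mul_log.measurable.comp
        (hf2.1.add_const (ε n))).aestronglyMeasurable)
      (integrable_const K) (fun n => ae_of_all _ fun x => hK _ (hmem n x))
      (ae_of_all _ fun x => (Real.continuous_mul_log.tendsto _).comp (hpt x))
  have h2 : Tendsto (fun n => ∫ x, (f x ^ 2 + ε n) ∂μ) atTop (𝓝 (∫ x, f x ^ 2 ∂μ)) := by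
    have h3 : ∀ n, ∫ x, (f x ^ 2 + ε n) ∂μ = (∫ x, f x ^ 2 ∂μ) + ε n := fun n => by
      rw [integral_add (hf2.integrable μ) (integrable_const _)]
      simp
    simp only [h3]
    simpa using hεt.const_add (∫ x, f x ^ 2 ∂μ)
  refine le_of_tendsto' (h1.sub ((Real.continuous_mul_log.tendsto _).comp h2)) fun n => ?_
  exact hU.realEntropy_add_const_le hα hf (hε0 n)

end

end SpinSystem

/-! ### Passage to the closed Dirichlet form. -/

namespace SpinSystem

section LpConvergence

variable {Ω F : Type*} [MeasurableSpace Ω] {μ : Measure Ω} [NormedAddCommGroup F]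

theorem toReal_eLpNorm_two_sq {f : Ω → F} (hf : MemLp f 2 μ) :
    (eLpNorm f 2 μ).toReal ^ 2 = ∫ x, ‖f x‖ ^ 2 ∂μ := by
  have h0 : 0 ≤ ∫ x, ‖f x‖ ^ 2 ∂μ := integral_nonneg fun x => sq_nonneg _
  rw [hf.eLpNorm_eq_integral_rpow_norm two_ne_zero ENNReal.ofNat_ne_top]
  simp only [ENNReal.toReal_ofNat, Real.rpow_ofNat]
  rw [ENNReal.toReal_ofReal (by positivity), ← Real.rpow_natCast, ← Real.rpow_mul h0]
  simp

theorem tendsto_integral_norm_sq {f : ℕ → Ω → F} {g : Ω → F} (hf : ∀ n, MemLp (f n) 2 μ)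
    (hg : MemLp g 2 μ) (h : Tendsto (fun n => eLpNorm (fun x => f n x - g x) 2 μ) atTop (𝓝 0)) :
    Tendsto (fun n => ∫ x, ‖f n x‖ ^ 2 ∂μ) atTop (𝓝 (∫ x, ‖g x‖ ^ 2 ∂μ)) := by
  have h1 := ((Lp.tendsto_Lp_iff_tendsto_eLpNorm'' f hf g hg).2 h).norm.pow 2
  simpa only [Lp.norm_toLp, toReal_eLpNorm_two_sq, hf, hg] using h1

theorem tendsto_eLpNorm_two_zero [IsFiniteMeasure μ] {f : ℕ → Ω → F} {C : ℝ}
    (hf : ∀ n, AEStronglyMeasurable (f n) μ) (hC : ∀ n x, ‖f n x‖ ≤ C)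
    (h : ∀ x, Tendsto (fun n => f n x) atTop (𝓝 0)) :
    Tendsto (fun n => eLpNorm (f n) 2 μ) atTop (𝓝 0) := by
  have hm : ∀ n, MemLp (f n) 2 μ := fun n => MemLp.of_bound (hf n) C (ae_of_all _ (hC n))
  have h1 : Tendsto (fun n => ∫ x, ‖f n x‖ ^ 2 ∂μ) atTop (𝓝 (∫ _, (0 : ℝ) ∂μ)) := by
    refine tendsto_integral_of_dominated_convergence (fun _ => C ^ 2)
      (fun n => ((hf n).norm.pow 2)) (integrable_const _) (fun n => ae_of_all _ fun x => ?_)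
      (ae_of_all _ fun x => ?_)
    · rw [Real.norm_of_nonneg (sq_nonneg _)]
      exact pow_le_pow_left₀ (norm_nonneg _) (hC n x) 2
    · simpa using (h x).norm.pow 2
  have h2 : ∀ n, eLpNorm (f n) 2 μ = ENNReal.ofReal √(∫ x, ‖f n x‖ ^ 2 ∂μ) := fun n => by
    rw [← toReal_eLpNorm_two_sq (hm n), Real.sqrt_sq ENNReal.toReal_nonneg,
      ENNReal.ofReal_toReal (hm n).eLpNorm_ne_top]
  simp only [h2]
  simpa using ENNReal.tendsto_ofReal (h1.sqrt)

end LpConvergence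

section

variable {ι : Type*} [Fintype ι]

theorem entropy_eq_realEntropy {Ω : Type*} [MeasurableSpace Ω] {μ : Measure Ω} {g : Ω → ℝ}
    (h : Integrable (fun x => g x * Real.log (g x)) μ) : entropy μ g = (realEntropy μ g : ℝ) := by
  rw [entropy, if_pos h, realEntropy]

namespace IsTestFunction

variable {f : EuclideanSpace ℝ ι → ℝ}

theorem memLp (hf : IsTestFunction f) (μ : Measure (EuclideanSpace ℝ ι)) [IsFiniteMeasure μ] :
    MemLp f 2 μ :=
  let ⟨C, hC⟩ := hf.isBddMeasurable.2
  MemLp.of_bound hf.1.continuous.aestronglyMeasurable C (ae_of_all _ hC)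

theorem memLp_gradient (hf : IsTestFunction f) (μ : Measure (EuclideanSpace ℝ ι))
    [IsFiniteMeasure μ] : MemLp (gradient f) 2 μ :=
  let ⟨C, hC⟩ := hf.exists_norm_gradient_le
  MemLp.of_bound hf.continuous_gradient.aestronglyMeasurable C (ae_of_all _ hC)

theorem const_mul_add (hf : IsTestFunction f) {g : EuclideanSpace ℝ ι → ℝ} (hg : IsTestFunction g)
    (a b : ℝ) : IsTestFunction (fun x => a * f x + b * g x) :=
  ⟨(contDiff_const.mul hf.1).add (contDiff_const.mul hg.1), hf.2.mul_left.add hg.2.mul_left⟩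

theorem gradient_const_mul_add (hf : IsTestFunction f) {g : EuclideanSpace ℝ ι → ℝ}
    (hg : IsTestFunction g) (a b : ℝ) (x : EuclideanSpace ℝ ι) :
    gradient (fun x => a * f x + b * g x) x = a • gradient f x + b • gradient g x := by
  have h1 : HasFDerivAt (fun x => a * f x + b * g x) (a • fderiv ℝ f x + b • fderiv ℝ g x) x :=
    ((hf.differentiable x).hasFDerivAt.const_mul a).add
      ((hg.differentiable x).hasFDerivAt.const_mul b)
  rw [gradient, gradient, gradient, h1.fderiv]
  simp

end IsTestFunction

/-- Test functions increasing to `1` whose gradients tend to `0` uniformly. -/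
theorem exists_cutoff : ∃ (χ : ℕ → EuclideanSpace ℝ ι → ℝ) (C : ℝ), (∀ n, IsTestFunction (χ n)) ∧
    (∀ n x, |χ n x| ≤ 1) ∧ (∀ x, ∀ᶠ n in atTop, χ n x = 1) ∧
    ∀ n x, ‖gradient (χ n) x‖ ≤ 1 / ((n : ℝ) + 1) * C := by
  set ψ : ContDiffBump (0 : EuclideanSpace ℝ ι) := ⟨1, 2, one_pos, one_lt_two⟩ with hψ
  have hT : IsTestFunction (ψ : EuclideanSpace ℝ ι → ℝ) := ⟨ψ.contDiff, ψ.hasCompactSupport⟩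
  obtain ⟨C, hC⟩ := hT.exists_norm_gradient_le
  have hpos : ∀ n : ℕ, 0 < 1 / ((n : ℝ) + 1) := fun n => Nat.one_div_pos_of_nat
  refine ⟨fun n x => ψ ((1 / ((n : ℝ) + 1)) • x), C, fun n => ⟨?_, ?_⟩, fun n x => ?_, fun x => ?_,
    fun n x => ?_⟩
  · exact ψ.contDiff.comp (contDiff_const_smul _)
  · exact ψ.hasCompactSupport.comp_smul (hpos n).ne'
  · rw [abs_of_nonneg ψ.nonneg]
    exact ψ.le_one
  · have h : Tendsto (fun n : ℕ => (1 / ((n : ℝ) + 1)) • x) atTop (𝓝 0) := by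
      simpa using (tendsto_one_div_add_atTop_nhds_zero_nat (𝕜 := ℝ)).smul_const x
    filter_upwards [h.eventually (Metric.closedBall_mem_nhds _ one_pos)] with n hn
    exact ψ.one_of_mem_closedBall hn
  · have h := fderiv_comp_smul (𝕜 := ℝ) (f := ψ) (x := x) (1 / ((n : ℝ) + 1))
    have h2 := hC ((1 / ((n : ℝ) + 1)) • x)
    rw [gradient, LinearIsometryEquiv.norm_map] at h2 ⊢
    rw [h, norm_smul, Real.norm_of_nonneg (hpos n).le]
    exact mul_le_mul_of_nonneg_left h2 (hpos n).le

/-- The domain of the Dirichlet form contains the constants and the test functions. -/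
theorem IsTestFunction.hasFormGradient_const_add {U : EuclideanSpace ℝ ι → ℝ}
    [IsProbabilityMeasure (gibbsMeasure U)] {f : EuclideanSpace ℝ ι → ℝ} (hf : IsTestFunction f)
    (a b : ℝ) : HasFormGradient U (fun x => a + b * f x) (fun x => b • gradient f x) := by
  -- Constants are not compactly supported, so `a` is approximated by `a χ n`, whose gradient is
  -- `O(1 / n)`.
  obtain ⟨χ, C, hχ, hχ1, hχt, hχg⟩ := exists_cutoff (ι := ι)
  refine ⟨(memLp_const a).add ((hf.memLp _).const_mul b), (hf.memLp_gradient _).const_smul b,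
    fun n x => a * χ n x + b * f x, fun n => (hχ n).const_mul_add hf a b, ?_, ?_⟩
  · refine tendsto_eLpNorm_two_zero (C := |a| * 2) (fun n => ?_) (fun n x => ?_) fun x => ?_
    · exact (((hχ n).const_mul_add hf a b).1.continuous.sub
        (continuous_const.add (continuous_const.mul hf.1.continuous))).aestronglyMeasurable
    · have : a * χ n x + b * f x - (a + b * f x) = a * (χ n x - 1) := by ring
      rw [this, Real.norm_eq_abs, abs_mul]
      have := abs_le.1 (hχ1 n x)
      exact mul_le_mul_of_nonneg_left (abs_le.2 ⟨by linarith, by linarith⟩) (abs_nonneg _)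
    · refine tendsto_const_nhds.congr' ?_
      filter_upwards [hχt x] with n hn
      simp [hn]
  · have h : ∀ n x, gradient (fun x => a * χ n x + b * f x) x - b • gradient f x =
        a • gradient (χ n) x := fun n x => by
      rw [(hχ n).gradient_const_mul_add hf]
      simp
    have hle : ∀ n x, ‖a • gradient (χ n) x‖ ≤ |a| * (1 / ((n : ℝ) + 1) * C) := fun n x => by
      rw [norm_smul, Real.norm_eq_abs]
      exact mul_le_mul_of_nonneg_left (hχg n x) (abs_nonneg _)
    simp only [h]
    have hC : 0 ≤ C := by simpa using (norm_nonneg _).trans (hχg 0 0)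
    refine tendsto_eLpNorm_two_zero (C := |a| * C) (fun n => ?_) (fun n x => ?_) fun x => ?_
    · exact ((hχ n).continuous_gradient.const_smul a).aestronglyMeasurable
    · refine (hle n x).trans (mul_le_mul_of_nonneg_left (mul_le_of_le_one_left hC ?_) (abs_nonneg _))
      have : (0 : ℝ) ≤ n := n.cast_nonneg
      exact div_le_one_of_le₀ (by linarith) (by linarith)
    · refine squeeze_zero_norm (fun n => hle n x) ?_
      simpa using ((tendsto_one_div_add_atTop_nhds_zero_nat (𝕜 := ℝ)).mul_const C).const_mul |a|

/-- The logarithmic Sobolev inequality passes from test functions to the domain of the closed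
form. -/
theorem HasFormGradient.entropy_sq_le {U : EuclideanSpace ℝ ι → ℝ}
    [IsProbabilityMeasure (gibbsMeasure U)] {K : ℝ}
    (hK : ∀ f, IsTestFunction f → realEntropy (gibbsMeasure U) (fun x => f x ^ 2) ≤
      K * ∫ x, ‖gradient f x‖ ^ 2 ∂(gibbsMeasure U))
    {f : EuclideanSpace ℝ ι → ℝ} {G : EuclideanSpace ℝ ι → EuclideanSpace ℝ ι}
    (hf : HasFormGradient U f G) :
    entropy (gibbsMeasure U) (fun x => f x ^ 2) ≤
      ((K * ∫ x, ‖G x‖ ^ 2 ∂(gibbsMeasure U) : ℝ) : EReal) := by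
  obtain ⟨hfL, hGL, φ, hφ, hφf, hφG⟩ := hf
  set μ := gibbsMeasure U with hμ
  obtain ⟨k, hk, hae⟩ := (tendstoInMeasure_of_tendsto_eLpNorm two_ne_zero
    (fun n => ((hφ n).memLp μ).1) hfL.1 hφf).exists_seq_tendsto_ae
  have hD := (tendsto_integral_norm_sq (fun n => (hφ n).memLp_gradient μ) hGL hφG).comp
    hk.tendsto_atTop
  have hm : Tendsto (fun n => ∫ x, φ (k n) x ^ 2 ∂μ) atTop (𝓝 (∫ x, f x ^ 2 ∂μ)) := by
    simpa using! (tendsto_integral_norm_sq (fun n => (hφ n).memLp μ) hfL hφf).comp hk.tendsto_atTop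
  have hml := (Real.continuous_mul_log.tendsto _).comp hm
  have hc := ((hD.const_mul K).add hml).add_const 1
  set c := K * ∫ x, ‖G x‖ ^ 2 ∂μ + (∫ x, f x ^ 2 ∂μ) * Real.log (∫ x, f x ^ 2 ∂μ) + 1 with hcdef
  -- By `t log t ≥ t - 1`, adding `1` makes the integrand nonnegative, so Fatou applies along an
  -- almost everywhere convergent subsequence. The finite bound also proves integrability, which
  -- rules out the value `⊤` of `entropy`.
  set F : ℝ → ℝ := fun s => s ^ 2 * Real.log (s ^ 2) + 1 with hF
  have hFc : Continuous F := (Real.continuous_mul_log.comp (continuous_pow 2)).add continuous_const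
  have hF0 : ∀ s, 0 ≤ F s := fun s => by
    have := Real.self_sub_one_le_mul_log (sq_nonneg s)
    simp only [hF]
    nlinarith [sq_nonneg s]
  have hFB : ∀ n, IsBddMeasurable fun x => F (φ (k n) x) := fun n => by
    obtain ⟨C, hC⟩ := (hφ (k n)).isBddMeasurable.2
    obtain ⟨B, hB⟩ := (isCompact_Icc (a := -C) (b := C)).exists_bound_of_continuousOn
      hFc.continuousOn
    exact ⟨hFc.measurable.comp (hφ (k n)).isBddMeasurable.1, B, fun x => hB _ (abs_le.1 (hC x))⟩
  have hFle : ∀ n, ∫ x, F (φ (k n) x) ∂μ ≤ K * ∫ x, ‖gradient (φ (k n)) x‖ ^ 2 ∂μ +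
      (∫ x, φ (k n) x ^ 2 ∂μ) * Real.log (∫ x, φ (k n) x ^ 2 ∂μ) + 1 := fun n => by
    have h := hK _ (hφ (k n))
    have h2 : ∫ x, F (φ (k n) x) ∂μ = ∫ x, φ (k n) x ^ 2 * Real.log (φ (k n) x ^ 2) ∂μ + 1 := by
      have h3 := ((hFB n).sub (.const 1)).integrable μ
      simp only [hF, add_sub_cancel_right] at h3 ⊢
      rw [integral_add h3 (integrable_const _)]
      simp
    rw [realEntropy] at h
    linarith
  have hc0 : 0 ≤ c := ge_of_tendsto' hc fun n => (integral_nonneg fun x => hF0 _).trans (hFle n)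
  have hfatou : ∫⁻ x, ENNReal.ofReal (F (f x)) ∂μ ≤ ENNReal.ofReal c := by
    have h1 : ∫⁻ x, ENNReal.ofReal (F (f x)) ∂μ =
        ∫⁻ x, liminf (fun n => ENNReal.ofReal (F (φ (k n) x))) atTop ∂μ := by
      refine lintegral_congr_ae ?_
      filter_upwards [hae] with x hx
      exact ((ENNReal.tendsto_ofReal ((hFc.tendsto _).comp hx)).liminf_eq).symm
    rw [h1, ← (ENNReal.tendsto_ofReal hc).liminf_eq]
    refine (lintegral_liminf_le fun n => (hFB n).1.ennreal_ofReal).trans (liminf_le_liminf ?_)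
    refine Eventually.of_forall fun n => ?_
    rw [← ofReal_integral_eq_lintegral_ofReal ((hFB n).integrable μ) (ae_of_all _ fun x => hF0 _)]
    exact ENNReal.ofReal_le_ofReal (hFle n)
  have hFm : AEStronglyMeasurable (fun x => F (f x)) μ := hFc.comp_aestronglyMeasurable hfL.1
  have hFi : Integrable (fun x => F (f x)) μ := by
    refine ⟨hFm, ?_⟩
    rw [hasFiniteIntegral_iff_ofReal (ae_of_all _ fun x => hF0 _)]
    exact hfatou.trans_lt ENNReal.ofReal_lt_top
  have hFc' : ∫ x, F (f x) ∂μ ≤ c := by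
    rw [integral_eq_lintegral_of_nonneg_ae (ae_of_all _ fun x => hF0 _) hFm]
    exact ENNReal.toReal_le_of_le_ofReal hc0 hfatou
  have hi : Integrable (fun x => f x ^ 2 * Real.log (f x ^ 2)) μ := by
    refine (hFi.sub (integrable_const (1 : ℝ))).congr (ae_of_all _ fun x => ?_)
    simp [hF]
  rw [entropy_eq_realEntropy hi, EReal.coe_le_coe_iff, realEntropy]
  have h2 : ∫ x, F (f x) ∂μ = ∫ x, f x ^ 2 * Real.log (f x ^ 2) ∂μ + 1 := by
    simp only [hF]
    rw [integral_add hi (integrable_const _)]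
    simp
  linarith

theorem IsQuadratic.le_logSobolevConstant {α : ℝ} (hα : 0 < α) {U : EuclideanSpace ℝ ι → ℝ}
    (hU : IsQuadratic α U) : ((2 * α : ℝ) : EReal) ≤ logSobolevConstant U := by
  have := hU.isProbabilityMeasure hα
  refine le_sSup ⟨2 * α, fun f G hf => ?_, rfl⟩
  have h := hf.entropy_sq_le fun φ hφ => hU.realEntropy_sq_le hα hφ
  refine (mul_le_mul_of_nonneg_left h (EReal.coe_nonneg.2 (by positivity))).trans_eq ?_
  rw [← EReal.coe_mul]
  congr 1
  field_simp

/-! ### From logarithmic Sobolev to Poincaré by linearization. -/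

/-- Insert `log (1 + s) ≥ s - s² / 2 - 2 |s|³`. The cubic terms of `(1 + s)² (2s - s²)` cancel,
leaving `2s + 3s² - s⁴`; the errors are at most `9 |s|³` and `|s|³ / 2`. -/
theorem le_one_add_sq_mul_log {s : ℝ} (hs : |s| ≤ 1 / 2) :
    2 * s + 3 * s ^ 2 - 10 * |s| ^ 3 ≤ (1 + s) ^ 2 * Real.log ((1 + s) ^ 2) := by
  have h := Real.abs_log_sub_add_sum_range_le (x := -s) (by rw [abs_neg]; linarith) 2
  rw [abs_neg] at h
  have h1 : |s| ^ 3 / (1 - |s|) ≤ 2 * |s| ^ 3 := by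
    rw [div_le_iff₀ (by linarith)]
    nlinarith [pow_nonneg (abs_nonneg s) 3]
  have h2 := (abs_le.1 (h.trans h1)).1
  simp only [Finset.sum_range_succ, Finset.sum_range_zero] at h2
  norm_num at h2
  have hs' := abs_le.1 hs
  have h3 : s ^ 4 ≤ |s| ^ 3 / 2 := by
    have : s ^ 4 = |s| ^ 3 * |s| := by
      rw [← pow_succ, Even.pow_abs (by decide)]
    rw [this]
    nlinarith [pow_nonneg (abs_nonneg s) 3]
  have h4 : (1 + s) ^ 2 ≤ 9 / 4 := by nlinarith
  have h5 : s - s ^ 2 / 2 - 2 * |s| ^ 3 ≤ Real.log (1 + s) := by linarith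
  have h6 := mul_le_mul_of_nonneg_left h5 (sq_nonneg (1 + s))
  have h7 := mul_le_mul_of_nonneg_right h4 (pow_nonneg (abs_nonneg s) 3)
  rw [Real.log_pow]
  push_cast
  nlinarith [h6, h7, h3]

/-- Second order expansion of the entropy of `(1 + t h)²` for a centred bounded `h`. -/
theorem le_realEntropy_one_add_sq {Ω : Type*} [MeasurableSpace Ω] {μ : Measure Ω}
    [IsProbabilityMeasure μ] {h : Ω → ℝ} (hh : IsBddMeasurable h) {M : ℝ} (hM : ∀ x, |h x| ≤ M)
    (h0 : ∫ x, h x ∂μ = 0) {t : ℝ} (ht : 0 ≤ t) (htM : t * M ≤ 1 / 2) :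
    2 * t ^ 2 * ∫ x, h x ^ 2 ∂μ - 10 * (t * M) ^ 3 - t ^ 4 * (∫ x, h x ^ 2 ∂μ) ^ 2 ≤
      realEntropy μ (fun x => (1 + t * h x) ^ 2) := by
  set V := ∫ x, h x ^ 2 ∂μ with hV
  have hV0 : 0 ≤ V := integral_nonneg fun x => sq_nonneg _
  have hs : ∀ x, |t * h x| ≤ t * M := fun x => by
    rw [abs_mul, abs_of_nonneg ht]
    exact mul_le_mul_of_nonneg_left (hM x) ht
  have hs2 : ∀ x, 1 / 4 ≤ (1 + t * h x) ^ 2 := fun x => by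
    have := abs_le.1 ((hs x).trans htM)
    nlinarith
  have hh2 : IsBddMeasurable fun x => h x ^ 2 := by simpa only [pow_two] using hh.mul hh
  have hg : IsBddMeasurable fun x => (1 + t * h x) ^ 2 := by
    have := (IsBddMeasurable.const 1).add ((IsBddMeasurable.const t).mul hh)
    simpa only [pow_two] using this.mul this
  have hL : ∀ r : ℝ, IsBddMeasurable fun x => r * h x := fun r => (IsBddMeasurable.const r).mul hh
  have hS : ∀ r : ℝ, IsBddMeasurable fun x => r * h x ^ 2 := fun r =>
    (IsBddMeasurable.const r).mul hh2
  have hmean : ∫ x, (1 + t * h x) ^ 2 ∂μ = 1 + t ^ 2 * V := by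
    have : ∀ x, (1 + t * h x) ^ 2 = 1 + 2 * t * h x + t ^ 2 * h x ^ 2 := fun x => by ring
    simp only [this]
    rw [integral_add (((IsBddMeasurable.const 1).add (hL (2 * t))).integrable μ)
      ((hS (t ^ 2)).integrable μ), integral_add (integrable_const _)
      ((hL (2 * t)).integrable μ), integral_const_mul, integral_const_mul, h0, ← hV]
    simp
  have hpt : ∀ x, 2 * t * h x + 3 * t ^ 2 * h x ^ 2 - 10 * (t * M) ^ 3 ≤
      (1 + t * h x) ^ 2 * Real.log ((1 + t * h x) ^ 2) := fun x => by
    have h1 := le_one_add_sq_mul_log ((hs x).trans htM)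
    have h2 := pow_le_pow_left₀ (abs_nonneg _) (hs x) 3
    nlinarith
  have hLS := (hL (2 * t)).add (hS (3 * t ^ 2))
  have hI := integral_mono (μ := μ) ((hLS.sub (.const (10 * (t * M) ^ 3))).integrable μ)
    ((hg.mul (hg.log (by norm_num) hs2)).integrable μ) hpt
  rw [integral_sub (hLS.integrable μ) (integrable_const (10 * (t * M) ^ 3)),
    integral_add ((hL (2 * t)).integrable μ) ((hS (3 * t ^ 2)).integrable μ),
    integral_const_mul, integral_const_mul, h0, ← hV] at hI
  simp only [mul_zero, zero_add, integral_const, probReal_univ, one_smul] at hI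
  -- The mean term removes `t² V` to leading order, lowering the `3 t² V` of the pointwise bound to
  -- `2 t² V`.
  have hm : (1 + t ^ 2 * V) * Real.log (1 + t ^ 2 * V) ≤ t ^ 2 * V + t ^ 4 * V ^ 2 := by
    have h1 : 0 < 1 + t ^ 2 * V := by positivity
    have := mul_le_mul_of_nonneg_left (Real.log_le_sub_one_of_pos h1) h1.le
    nlinarith
  rw [realEntropy, hmean]
  linarith

/-- The logarithmic Sobolev inequality implies the Poincaré inequality. -/
theorem logSobolevConstant_le_spectralGap (U : EuclideanSpace ℝ ι → ℝ)
    [IsProbabilityMeasure (gibbsMeasure U)] : logSobolevConstant U ≤ spectralGap U := by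
  refine sSup_le_sSup (Set.image_mono fun κ hκ f hf => ?_)
  set μ := gibbsMeasure U with hμ
  set D := ∫ x, ‖gradient f x‖ ^ 2 ∂μ with hD
  have hD0 : 0 ≤ D := integral_nonneg fun x => sq_nonneg _
  rcases le_or_gt κ 0 with hκ0 | hκ0
  · exact (mul_nonpos_of_nonpos_of_nonneg hκ0 (variance_nonneg f μ)).trans hD0
  have hfB := hf.isBddMeasurable
  rw [variance_eq_integral hfB.1.aemeasurable]
  set c := ∫ x, f x ∂μ with hc
  have hh : IsBddMeasurable fun x => f x - c := hfB.sub (.const c)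
  obtain ⟨M₀, hM₀⟩ := hh.2
  -- A positive `M` makes `(0, 1 / (2M))` a nonempty range for `t`.
  set M := max M₀ 1 with hMdef
  have hM : ∀ x, |f x - c| ≤ M := fun x => (hM₀ x).trans (le_max_left _ _)
  have hM1 : 1 ≤ M := le_max_right _ _
  have h0 : ∫ x, (f x - c) ∂μ = 0 := by
    rw [integral_sub (hfB.integrable μ) (integrable_const _)]
    simp [hc]
  set V := ∫ x, (f x - c) ^ 2 ∂μ with hV
  -- The inequality for `1 + t (f - c)`, divided by `2 t²`: the errors `10 (t M)³` and `t⁴ V²`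
  -- become `5 M³ t` and `V² t² / 2`, which vanish as `t → 0`.
  have key : ∀ᶠ t in 𝓝[>] (0 : ℝ), κ * V - κ * (5 * M ^ 3) * t - κ * V ^ 2 / 2 * t ^ 2 ≤ D := by
    have hpos : 0 < 1 / (2 * M) := by positivity
    filter_upwards [Ioo_mem_nhdsGT hpos] with t ht
    have htM : t * M ≤ 1 / 2 := by
      have := (lt_div_iff₀ (by positivity)).1 ht.2
      linarith
    have hE := le_realEntropy_one_add_sq hh hM h0 ht.1.le htM
    rw [← hV] at hE
    have heq : (fun x => (1 - t * c) + t * f x) = fun x => 1 + t * (f x - c) := by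
      ext x; ring
    have hdom := hf.hasFormGradient_const_add (U := U) (1 - t * c) t
    rw [heq] at hdom
    have hL := hκ _ _ hdom
    have hg : IsBddMeasurable fun x => (1 + t * (f x - c)) ^ 2 := by
      have := (IsBddMeasurable.const 1).add ((IsBddMeasurable.const t).mul hh)
      simpa only [pow_two] using this.mul this
    have hs2 : ∀ x, 1 / 4 ≤ (1 + t * (f x - c)) ^ 2 := fun x => by
      have h1 : |t * (f x - c)| ≤ 1 / 2 := by
        rw [abs_mul, abs_of_pos ht.1]
        exact (mul_le_mul_of_nonneg_left (hM x) ht.1.le).trans htM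
      have := abs_le.1 h1
      nlinarith
    rw [entropy_eq_realEntropy ((hg.mul (hg.log (by norm_num) hs2)).integrable _),
      ← EReal.coe_mul, EReal.coe_le_coe_iff] at hL
    have hn : ∀ x, ‖t • gradient f x‖ ^ 2 = t ^ 2 * ‖gradient f x‖ ^ 2 := fun x => by
      rw [norm_smul, mul_pow, Real.norm_eq_abs, sq_abs]
    simp only [hn] at hL
    rw [integral_const_mul, ← hD] at hL
    have h3 := (mul_le_mul_of_nonneg_left hE hκ0.le).trans hL
    have h4 : 2 * t ^ 2 * (κ * V - κ * (5 * M ^ 3) * t - κ * V ^ 2 / 2 * t ^ 2) ≤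
        2 * t ^ 2 * D := by
      linarith
    exact le_of_mul_le_mul_left h4 (mul_pos two_pos (pow_pos ht.1 2))
  refine le_of_tendsto ?_ key
  have hcont : Continuous fun t : ℝ => κ * V - κ * (5 * M ^ 3) * t - κ * V ^ 2 / 2 * t ^ 2 := by
    fun_prop
  have := (hcont.tendsto 0).mono_left (nhdsWithin_le_nhds (s := Set.Ioi 0))
  simpa using this

end

/-! ### The lattice potential. -/

/-- The one-site terms alone supply the bound `α`; every other term is a square of an affine
function with nonnegative weight and contributes `0`. -/
theorem isQuadratic_latticePotential {d : ℕ} {α J : ℝ} (hJ : 0 ≤ J) (Λ : Finset (Fin d → ℤ))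
    (ω : (Fin d → ℤ) → ℝ) : IsQuadratic α (latticePotential (fun t => α * t ^ 2) J Λ ω) := by
  have hdiff : ∀ i j : Λ, IsQuadratic 0 fun x : EuclideanSpace ℝ Λ => (x i - x j) ^ 2 :=
    fun i j => by
      have h := IsQuadratic.inner_sub_sq
        (EuclideanSpace.single i (1 : ℝ) - EuclideanSpace.single j (1 : ℝ)) 0
      have hx : ∀ x : EuclideanSpace ℝ Λ,
          ⟪EuclideanSpace.single i (1 : ℝ) - EuclideanSpace.single j (1 : ℝ), x⟫_ℝ - 0 =
            x i - x j := fun x => by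
        rw [inner_sub_left, EuclideanSpace.inner_single_left, EuclideanSpace.inner_single_left]
        simp
      simpa only [hx] using h
  have hbdry : ∀ (i : Λ) (c : ℝ), IsQuadratic 0 fun x : EuclideanSpace ℝ Λ => (x i - c) ^ 2 :=
    fun i c => by
      simpa [EuclideanSpace.inner_single_left] using
        IsQuadratic.inner_sub_sq (EuclideanSpace.single i (1 : ℝ)) c
  have hself : IsQuadratic α fun x : EuclideanSpace ℝ Λ => ∑ i : Λ, α * x i ^ 2 := by
    simpa [EuclideanSpace.real_norm_sq_eq, Finset.mul_sum] using
      IsQuadratic.mul_norm_sq (ι := Λ) α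
  have h := (hself.add (((IsQuadratic.finsetSum Finset.univ fun i : Λ =>
    IsQuadratic.finsetSum (Finset.univ.filter fun j : Λ =>
      (j : Fin d → ℤ) ∈ neighbours (i : Fin d → ℤ)) (hdiff i)).const_mul
        (r := 1 / 2) (by norm_num)).const_mul hJ)).add
    ((IsQuadratic.finsetSum Finset.univ fun i : Λ =>
      IsQuadratic.finsetSum (neighbours (i : Fin d → ℤ) \ Λ) fun j => hbdry i (ω j)).const_mul hJ)
  rw [add_zero, add_zero] at h
  exact h

end SpinSystem

theorem theorem6p2 (d : ℕ) (hd : 1 ≤ d) (α J : ℝ) (hα : 0 < α) (hJ : 0 ≤ J) :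
    (∀ (Λ : Finset (Fin d → ℤ)) (ω : (Fin d → ℤ) → ℝ),
      IsProbabilityMeasure
        (SpinSystem.gibbsMeasure (SpinSystem.latticePotential (fun t => α * t ^ 2) J Λ ω))) ∧
    (⨅ (Λ : Finset (Fin d → ℤ)) (ω : (Fin d → ℤ) → ℝ),
        SpinSystem.spectralGap (SpinSystem.latticePotential (fun t => α * t ^ 2) J Λ ω)) ≥
      (⨅ (Λ : Finset (Fin d → ℤ)) (ω : (Fin d → ℤ) → ℝ),
        SpinSystem.logSobolevConstant (SpinSystem.latticePotential (fun t => α * t ^ 2) J Λ ω)) ∧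
    (⨅ (Λ : Finset (Fin d → ℤ)) (ω : (Fin d → ℤ) → ℝ),
        SpinSystem.logSobolevConstant (SpinSystem.latticePotential (fun t => α * t ^ 2) J Λ ω)) ≥
      ((2 * α : ℝ) : EReal) := by
  have hQ := fun Λ ω => SpinSystem.isQuadratic_latticePotential (d := d) (α := α) hJ Λ ω
  have hP := fun Λ ω => (hQ Λ ω).isProbabilityMeasure hα
  refine ⟨hP, iInf_mono fun Λ => iInf_mono fun ω => ?_, le_iInf fun Λ => le_iInf fun ω =>
    (hQ Λ ω).le_logSobolevConstant hα⟩
  have := hP Λ ω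
  exact SpinSystem.logSobolevConstant_le_spectralGap _
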